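/- Let $d\in\{1,2,3\}$, let $\omega_1,\dots,\omega_d>0$, put $\Omega(x)=\sum_{j=1}^d\omega_j^2x_j^2$ on $\mathbb{R}^d$ and $A=-\Delta+\Omega$. Let $\varphi_n(t)=(2^n\,n!\,\sqrt{\pi})^{-1/2}H_n(t)e^{-t^2/2}$ be the normalised Hermite functions, where $H_n$ is the $n$-th (physicists') Hermite polynomial, and for $\mathbf{k}\in\mathbb{N}_0^d$ let $$\varphi_{\mathbf{k}}(x)=\prod_{j=1}^d\omega_j^{1/4}\varphi_{k_j}(\sqrt{\omega_j}\,x_j),\qquad \lambda_{\mathbf{k}}=\sum_{j=1}^d\omega_j(2k_j+1)$$ be the $L^2$-normalised eigenfunctions and the eigenvalues of $A$. Let $\tilde H^2(\mathbb{R}^d)$ be the linear space of all $u\in L^2(\mathbb{R}^d;\mathbb{C})$ for which $$\|u\|_{\tilde H^2}^2=\sum_{\mathbf{k}\in\mathbb{N}_0^d}\lambda_{\mathbf{k}}^2\,|\langle\varphi_{\mathbf{k}},u\rangle_{L^2}|^2$$ is finite. Then $\tilde H^2(\mathbb{R}^d)=D(A)$, the set of all $u\in L^2(\mathbb{R}^d;\mathbb{C})$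 such that the tempered distribution $Au=-\Delta u+\Omega u$ belongs to $L^2$, with $\|u\|_{\tilde H^2}=\|Au\|_{L^2}$ for all $u\in D(A)$; and $\tilde H^2(\mathbb{R}^d)$ is an algebra with the pointwise product: there is a constant $C>0$, depending only on $d$ and $\omega_1,\dots,\omega_d$, such that for all $u,v\in\tilde H^2(\mathbb{R}^d)$ one has $uv\in\tilde H^2(\mathbb{R}^d)$ and $$\|uv\|_{\tilde H^2}\le C\,\|u\|_{\tilde H^2}\,\|v\|_{\tilde H^2}.$$ -/

import Mathlib

open MeasureTheory TemperedDistribution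
open scoped SchwartzMap Laplacian

/-- The `n`-th `L²(ℝ)`-normalised Hermite function `(2ⁿ n! √π)^{-1/2} Hₙ(x) e^{-x²/2}`. The
polynomials `Polynomial.hermite n` are the probabilists' ones, and `Hₙ(x) = 2^{n/2} Heₙ(√2 x)`. -/
noncomputable def hermiteFunction (n : ℕ) (x : ℝ) : ℝ :=
  (√((n.factorial : ℝ) * √Real.pi))⁻¹ *
    (Polynomial.aeval (√2 * x) (Polynomial.hermite n) * Real.exp (-(x ^ 2) / 2))

/-- The quadratic form `Ω(x) = ω₁² x₁² + ⋯ + ω_d² x_d²`. -/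
noncomputable def trapPotential {d : ℕ} (ω : Fin d → ℝ) (x : EuclideanSpace ℝ (Fin d)) : ℝ :=
  ∑ j, ω j ^ 2 * x j ^ 2

/-- The eigenvalue `λ_k = ∑ⱼ ωⱼ (2 kⱼ + 1)` of `-Δ + Ω`. -/
noncomputable def oscillatorEigenvalue {d : ℕ} (ω : Fin d → ℝ) (k : Fin d → ℕ) : ℝ :=
  ∑ j, ω j * (2 * (k j : ℝ) + 1)

/-- The normalised eigenfunction `φ_k(x) = ∏ⱼ ωⱼ^{1/4} φ_{kⱼ}(√ωⱼ xⱼ)` of `-Δ + Ω`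
(for `ωⱼ > 0`). -/
noncomputable def oscillatorEigenfunction {d : ℕ} (ω : Fin d → ℝ) (k : Fin d → ℕ)
    (x : EuclideanSpace ℝ (Fin d)) : ℝ :=
  ∏ j, ω j ^ (1 / 4 : ℝ) * hermiteFunction (k j) (√(ω j) * x j)

theorem continuous_hermiteFunction (n : ℕ) : Continuous (hermiteFunction n) := by
  unfold hermiteFunction
  fun_prop

theorem continuous_oscillatorEigenfunction {d : ℕ} (ω : Fin d → ℝ) (k : Fin d → ℕ) :
    Continuous (oscillatorEigenfunction ω k) := by
  have := continuous_hermiteFunction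
  unfold oscillatorEigenfunction
  fun_prop

theorem integrable_aeval_mul_exp_neg_sq (p : Polynomial ℝ) :
    Integrable (fun x : ℝ => p.eval x * Real.exp (-(x ^ 2))) := by
  induction p using Polynomial.induction_on' with
  | add p q hp hq =>
    refine (hp.add hq).congr (Filter.Eventually.of_forall fun x => ?_)
    simp [add_mul]
  | monomial n a =>
    have h := (integrable_rpow_mul_exp_neg_mul_sq (b := 1) one_pos
      (s := n) (by linarith [n.cast_nonneg (α := ℝ)])).const_mul a
    simpa [mul_assoc] using h

theorem integrable_hermiteFunction_sq (n : ℕ) :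
    Integrable (fun x : ℝ => hermiteFunction n x ^ 2) := by
  set c := (√((n.factorial : ℝ) * √Real.pi))⁻¹
  set q : Polynomial ℝ := ((Polynomial.hermite n).map (Int.castRingHom ℝ)).comp
    (Polynomial.C √2 * Polynomial.X)
  have h := (integrable_aeval_mul_exp_neg_sq (q ^ 2)).const_mul (c ^ 2)
  refine h.congr (Filter.Eventually.of_forall fun x => ?_)
  have e : Real.exp (-(x ^ 2)) = Real.exp (-(x ^ 2) / 2) ^ 2 := by
    rw [← Real.exp_nat_mul]; congr 1; push_cast; ring
  have hq : q.eval x = Polynomial.aeval (√2 * x) (Polynomial.hermite n) := by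
    simp [q, Polynomial.aeval_def, Polynomial.eval_map]
  simp only [hermiteFunction, Polynomial.eval_pow, hq, e]
  ring

theorem memLp_oscillatorEigenfunction {d : ℕ} {ω : Fin d → ℝ} (hω : ∀ j, 0 < ω j)
    (k : Fin d → ℕ) :
    MemLp (fun x => (oscillatorEigenfunction ω k x : ℂ)) 2 volume := by
  refine MemLp.ofReal (f := oscillatorEigenfunction ω k) ?_
  rw [memLp_two_iff_integrable_sq (continuous_oscillatorEigenfunction ω k).aestronglyMeasurable]
  have h : Integrable (fun x : Fin d → ℝ =>
      ∏ j, (ω j ^ (1 / 4 : ℝ)) ^ 2 * hermiteFunction (k j) (√(ω j) * x j) ^ 2) := by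
    refine Integrable.fintype_prod
      (f := fun j y => (ω j ^ (1 / 4 : ℝ)) ^ 2 * hermiteFunction (k j) (√(ω j) * y) ^ 2)
      fun j => Integrable.const_mul ?_ _
    exact (integrable_hermiteFunction_sq (k j)).comp_mul_left' (Real.sqrt_pos.2 (hω j)).ne'
  have h2 := (PiLp.volume_preserving_ofLp (Fin d)).integrable_comp_of_integrable h
  refine h2.congr (Filter.Eventually.of_forall fun x => ?_)
  simp [oscillatorEigenfunction, ← Finset.prod_pow, mul_pow]

/-- The eigenfunction `φ_k` as an element of `L²(ℝᵈ; ℂ)`. -/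
noncomputable def oscillatorEigenvector {d : ℕ} {ω : Fin d → ℝ} (hω : ∀ j, 0 < ω j)
    (k : Fin d → ℕ) : Lp ℂ 2 (volume : Measure (EuclideanSpace ℝ (Fin d))) :=
  (memLp_oscillatorEigenfunction hω k).toLp _

/-- The terms `λ_k^s |⟨φ_k, u⟩_{L²}|²` of the series that defines `‖u‖²` in `H̃ˢ(ℝᵈ)`. -/
noncomputable def hermiteSobolevTerm {d : ℕ} {ω : Fin d → ℝ} (hω : ∀ j, 0 < ω j) (s : ℝ)
    (u : Lp ℂ 2 (volume : Measure (EuclideanSpace ℝ (Fin d)))) (k : Fin d → ℕ) : ℝ :=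
  oscillatorEigenvalue ω k ^ s * ‖inner ℂ (oscillatorEigenvector hω k) u‖ ^ 2

theorem oscillatorEigenvalue_nonneg {d : ℕ} {ω : Fin d → ℝ} (hω : ∀ j, 0 < ω j)
    (k : Fin d → ℕ) : 0 ≤ oscillatorEigenvalue ω k :=
  Finset.sum_nonneg fun j _ => mul_nonneg (hω j).le (by positivity)

/-- The space `H̃ˢ(ℝᵈ) = D(A^{s/2})`, `A = -Δ + Ω`: all `u ∈ L²(ℝᵈ; ℂ)` for which
`∑_k λ_k^s |⟨φ_k, u⟩|²` is finite. -/
noncomputable def hermiteSobolev {d : ℕ} {ω : Fin d → ℝ} (hω : ∀ j, 0 < ω j) (s : ℝ) :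
    Submodule ℂ (Lp ℂ 2 (volume : Measure (EuclideanSpace ℝ (Fin d)))) where
  carrier := {u | Summable (hermiteSobolevTerm hω s u)}
  zero_mem' := by
    have h : hermiteSobolevTerm hω s 0 = 0 := by
      ext k
      simp [hermiteSobolevTerm]
    rw [Set.mem_ofPred_eq, h]
    exact summable_zero
  add_mem' := by
    intro u v hu hv
    refine Summable.of_nonneg_of_le (fun k => ?_) (fun k => ?_) ((hu.add hv).mul_left 2)
    · exact mul_nonneg (Real.rpow_nonneg (oscillatorEigenvalue_nonneg hω k) s) (sq_nonneg _)
    · have hk := Real.rpow_nonneg (oscillatorEigenvalue_nonneg hω k) s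
      simp only [hermiteSobolevTerm, inner_add_right]
      set a := inner ℂ (oscillatorEigenvector hω k) u
      set b := inner ℂ (oscillatorEigenvector hω k) v
      have h1 : ‖a + b‖ ^ 2 ≤ 2 * (‖a‖ ^ 2 + ‖b‖ ^ 2) := by
        have := norm_add_le a b
        nlinarith [sq_nonneg (‖a‖ - ‖b‖), norm_nonneg (a + b)]
      nlinarith [mul_le_mul_of_nonneg_left h1 hk]
  smul_mem' := by
    intro c u hu
    refine (Summable.mul_left (‖c‖ ^ 2) hu).congr fun k => ?_
    simp only [hermiteSobolevTerm, inner_smul_right, norm_mul]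
    ring

/-- The norm `‖u‖ = (∑_k λ_k^s |⟨φ_k, u⟩|²)^{1/2}` of `H̃ˢ(ℝᵈ)`; meaningful on
`hermiteSobolev hω s`. -/
noncomputable def hermiteSobolevNorm {d : ℕ} {ω : Fin d → ℝ} (hω : ∀ j, 0 < ω j) (s : ℝ)
    (u : Lp ℂ 2 (volume : Measure (EuclideanSpace ℝ (Fin d)))) : ℝ :=
  √(∑' k, hermiteSobolevTerm hω s u k)

/-- The potential has temperate growth, so that multiplication by it (below) is the genuine
multiplication of tempered distributions. -/
theorem hasTemperateGrowth_trapPotential {d : ℕ} (ω : Fin d → ℝ) :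
    (fun x : EuclideanSpace ℝ (Fin d) => (trapPotential ω x : ℂ)).HasTemperateGrowth := by
  have hj : ∀ j : Fin d,
      (fun x : EuclideanSpace ℝ (Fin d) => x j).HasTemperateGrowth := fun j =>
    (EuclideanSpace.proj (𝕜 := ℝ) j).hasTemperateGrowth
  have h : (fun x : EuclideanSpace ℝ (Fin d) => trapPotential ω x).HasTemperateGrowth := by
    unfold trapPotential
    fun_prop
  fun_prop

/-- The harmonic oscillator `A = -Δ + Ω` on tempered distributions on `ℝᵈ`. -/
noncomputable def harmonicOscillator {d : ℕ} (ω : Fin d → ℝ)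
    (T : 𝓢'(EuclideanSpace ℝ (Fin d), ℂ)) : 𝓢'(EuclideanSpace ℝ (Fin d), ℂ) :=
  -Δ T + smulLeftCLM ℂ (fun x => (trapPotential ω x : ℂ)) T

/-- `u ∈ D(A)` with `Au = f`, for the realisation of `A = -Δ + Ω` in `L²(ℝᵈ; ℂ)` whose domain
consists of all `u ∈ L²` such that the distribution `-Δu + Ωu` belongs to `L²`. -/
def IsHarmonicOscillatorValue {d : ℕ} (ω : Fin d → ℝ)
    (u f : Lp ℂ 2 (volume : Measure (EuclideanSpace ℝ (Fin d)))) : Prop :=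
  harmonicOscillator ω (Lp.toTemperedDistribution u) = Lp.toTemperedDistribution f

/-!
The eigenfunctions `φ_k` are orthonormal by the Hermite recursion. They are complete because a
function `g` orthogonal to all of them makes every polynomial moment of `e^{-∑ ωⱼxⱼ²/2} g` vanish,
and the Gaussian makes the exponential series of the Fourier transform converge, so that transform
is zero. Pairing `Au` with `φ_k` gives `⟨φ_k, Au⟩ = λ_k ⟨φ_k, u⟩`; conversely the partial sums of
the Hermite expansion are Schwartz functions and `A` is closed on tempered distributions. Parseval
then identifies `H̃²` with `D(A)` and its norm with `‖Au‖`.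

For the product, expanding `‖-Δf + Ωf‖²` bounds `‖Δf‖` and `‖Ωf‖` by `‖Af‖` for Schwartz `f`, since
`ΔΩ` is bounded and the bottom of the spectrum is positive. In dimension less than four
`‖f‖_∞ ≲ ‖Af‖` by Sobolev embedding, so in `A(fg) = -(Δf)g - fΔg - 2∇f·∇g + Ωfg` every term but the
gradient one is immediate, and that one follows from `‖∂f‖₄² ≤ 3 ‖f‖_∞ ‖∂²f‖₂`. Density of the
Hermite expansions extends the estimate to `D(A)`.
-/

open scoped LineDeriv FourierTransform InnerProductSpace

section Calculus

variable {E F : Type*} [NormedAddCommGroup E] [NormedSpace ℝ E]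
  [NormedAddCommGroup F] [NormedSpace ℝ F]

theorem hasTemperateGrowth_fderiv {g : E → F} (hg : g.HasTemperateGrowth) :
    (fderiv ℝ g).HasTemperateGrowth := by
  refine ⟨hg.1.fderiv_right (by simp), fun n => ?_⟩
  simpa only [norm_iteratedFDeriv_fderiv] using hg.2 (n + 1)

theorem hasTemperateGrowth_fderiv_apply {g : E → F} (hg : g.HasTemperateGrowth) (v : E) :
    (fun x => fderiv ℝ g x v).HasTemperateGrowth :=
  (ContinuousLinearMap.apply ℝ F v).hasTemperateGrowth.comp (hasTemperateGrowth_fderiv hg)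

theorem lineDerivOp_lineDerivOp_comm (f : 𝓢(E, F)) (v w : E) :
    ∂_{v} (∂_{w} f) = ∂_{w} (∂_{v} f) := by
  have hf' (x : E) : DifferentiableAt ℝ (fderiv ℝ f) x :=
    ((f.smooth 2).fderiv_right (m := 1) (by norm_num)).differentiable one_ne_zero x
  have second (u u' x : E) : ∂_{u} (∂_{u'} f) x = fderiv ℝ (fderiv ℝ f) x u u' := by
    change fderiv ℝ (fun y => fderiv ℝ f y u') x u = _
    simp [fderiv_clm_apply (hf' x) (differentiableAt_const u')]
  ext x
  rw [second, second]
  exact (f.smooth 2).contDiffAt.isSymmSndFDerivAt (by simp) v w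

theorem lineDerivOp_smulLeftCLM {𝕜 : Type*} [RCLike 𝕜] [NormedSpace 𝕜 F] {g : E → 𝕜}
    (hg : g.HasTemperateGrowth) (f : 𝓢(E, F)) (v : E) :
    ∂_{v} (SchwartzMap.smulLeftCLM F g f) =
      SchwartzMap.smulLeftCLM F (fun x => fderiv ℝ g x v) f +
        SchwartzMap.smulLeftCLM F g (∂_{v} f) := by
  ext x
  have hd : HasFDerivAt (SchwartzMap.smulLeftCLM F g f)
      (g x • fderiv ℝ f x + (fderiv ℝ g x).smulRight (f x)) x := by
    rw [SchwartzMap.smulLeftCLM_apply hg]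
    exact ((hg.1.differentiable (by simp)) x).hasFDerivAt.smul (f.hasFDerivAt x)
  simp only [SchwartzMap.lineDerivOp_apply_eq_fderiv, hd.fderiv, add_apply, smul_apply,
    ContinuousLinearMap.smulRight_apply,
    SchwartzMap.smulLeftCLM_apply_apply (hasTemperateGrowth_fderiv_apply hg v),
    SchwartzMap.smulLeftCLM_apply_apply hg]
  exact add_comm _ _

/-- The pointwise product of Schwartz functions. -/
noncomputable def schwartzMul (f g : 𝓢(E, ℂ)) : 𝓢(E, ℂ) :=
  SchwartzMap.pairing (ContinuousLinearMap.mul ℂ ℂ) f g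

/-- The pointwise complex conjugate of a Schwartz function. -/
noncomputable def schwartzConj (f : 𝓢(E, ℂ)) : 𝓢(E, ℂ) :=
  SchwartzMap.postcompCLM (Complex.conjCLE : ℂ →L[ℝ] ℂ) f

@[simp]
theorem schwartzMul_apply (f g : 𝓢(E, ℂ)) (x : E) : schwartzMul f g x = f x * g x := rfl

@[simp]
theorem schwartzConj_apply (f : 𝓢(E, ℂ)) (x : E) :
    schwartzConj f x = starRingEnd ℂ (f x) := rfl

theorem schwartzMul_comm (f g : 𝓢(E, ℂ)) : schwartzMul f g = schwartzMul g f := by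
  ext x
  simp [mul_comm]

theorem smulLeftCLM_schwartzMul {V : E → ℝ} (hV : V.HasTemperateGrowth) (f g : 𝓢(E, ℂ)) :
    SchwartzMap.smulLeftCLM ℂ V (schwartzMul f g) =
      schwartzMul (SchwartzMap.smulLeftCLM ℂ V f) g := by
  ext x
  simp [SchwartzMap.smulLeftCLM_apply_apply hV, mul_assoc]

theorem lineDerivOp_schwartzMul (f g : 𝓢(E, ℂ)) (v : E) :
    ∂_{v} (schwartzMul f g) = schwartzMul (∂_{v} f) g + schwartzMul f (∂_{v} g) := by
  ext x
  have h : HasFDerivAt (schwartzMul f g) (f x • fderiv ℝ g x + g x • fderiv ℝ f x) x :=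
    (f.hasFDerivAt x).mul (g.hasFDerivAt x)
  simp only [SchwartzMap.lineDerivOp_apply_eq_fderiv, h.fderiv, add_apply,
    schwartzMul_apply, smul_apply, smul_eq_mul]
  ring

theorem lineDerivOp_schwartzConj (f : 𝓢(E, ℂ)) (v : E) :
    ∂_{v} (schwartzConj f) = schwartzConj (∂_{v} f) := by
  ext x
  have h : HasFDerivAt (schwartzConj f) ((Complex.conjCLE : ℂ →L[ℝ] ℂ).comp (fderiv ℝ f x)) x :=
    (Complex.conjCLE : ℂ →L[ℝ] ℂ).hasFDerivAt.comp x (f.hasFDerivAt x)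
  simp [SchwartzMap.lineDerivOp_apply_eq_fderiv, h.fderiv]

theorem norm_lineDerivOp_mul_self_mul_conj_le (f : 𝓢(E, ℂ)) (v x : E) :
    ‖∂_{v} (schwartzMul (schwartzMul f f) (schwartzConj f)) x‖ ≤
      3 * (‖schwartzMul f f x‖ * ‖∂_{v} f x‖) := by
  simp only [lineDerivOp_schwartzMul, lineDerivOp_schwartzConj, add_apply,
    schwartzMul_apply, schwartzConj_apply]
  refine (norm_add_le _ _).trans ?_
  rw [show ∂_{v} f x * f x + f x * ∂_{v} f x = 2 * (∂_{v} f x * f x) by ring]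
  simp only [norm_mul, RCLike.norm_conj, Complex.norm_ofNat]
  linarith

end Calculus

section SchwartzL2

variable {E : Type*} [NormedAddCommGroup E] [InnerProductSpace ℝ E] [FiniteDimensional ℝ E]
  [MeasurableSpace E] [BorelSpace E]

/-- The embedding of the Schwartz space into `L²`. -/
noncomputable abbrev schwartzToL2 : 𝓢(E, ℂ) →L[ℂ] Lp ℂ 2 (volume : Measure E) :=
  SchwartzMap.toLpCLM ℂ ℂ 2 volume

theorem coeFn_schwartzToL2 (f : 𝓢(E, ℂ)) : schwartzToL2 f =ᵐ[volume] f :=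
  f.coeFn_toLp 2 volume

theorem norm_schwartzToL2_sq (f : 𝓢(E, ℂ)) : ‖schwartzToL2 f‖ ^ 2 = ∫ x, ‖f x‖ ^ 2 := by
  have h := SchwartzMap.norm_toLp' (f := f) (p := 2) (μ := volume) (by simp) (by simp)
  rw [SchwartzMap.toLpCLM_apply, h, ← Real.rpow_natCast, ← Real.rpow_mul (by positivity)]
  simp

theorem norm_schwartzToL2_le_mul {f g : 𝓢(E, ℂ)} {c : ℝ} (h : ∀ x, ‖f x‖ ≤ c * ‖g x‖) :
    ‖schwartzToL2 f‖ ≤ c * ‖schwartzToL2 g‖ := by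
  refine Lp.norm_le_mul_norm_of_ae_le_mul ?_
  filter_upwards [coeFn_schwartzToL2 f, coeFn_schwartzToL2 g] with x hf hg
  rw [hf, hg]
  exact h x

theorem real_inner_schwartzToL2 (f g : 𝓢(E, ℂ)) :
    ⟪schwartzToL2 f, schwartzToL2 g⟫_ℝ = ∫ x, ⟪f x, g x⟫_ℝ := by
  rw [L2.inner_def]
  refine integral_congr_ae ?_
  filter_upwards [coeFn_schwartzToL2 f, coeFn_schwartzToL2 g] with x hf hg
  rw [hf, hg]

theorem integral_mul_norm_le_sqrt_mul_norm_schwartzToL2 {w : E → ℝ} (hw : MemLp w 2)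
    (f : 𝓢(E, ℂ)) : ∫ x, ‖w x‖ * ‖f x‖ ≤ √(∫ x, w x ^ 2) * ‖schwartzToL2 f‖ := by
  have h := integral_mul_norm_le_Lp_mul_Lq (μ := volume) (f := w) (g := fun x => ‖f x‖)
    Real.HolderConjugate.two_two (by simpa using hw) (by simpa using (f.memLp 2 volume).norm)
  rw [← Real.sqrt_sq (norm_nonneg (schwartzToL2 f)), norm_schwartzToL2_sq, Real.sqrt_eq_rpow,
    Real.sqrt_eq_rpow]
  simpa using h

theorem integral_norm_mul_norm_le_norm_schwartzToL2 (f g : 𝓢(E, ℂ)) :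
    ∫ x, ‖f x‖ * ‖g x‖ ≤ ‖schwartzToL2 f‖ * ‖schwartzToL2 g‖ := by
  have h := integral_mul_norm_le_sqrt_mul_norm_schwartzToL2 (f.memLp 2 volume).norm g
  rw [← norm_schwartzToL2_sq, Real.sqrt_sq (norm_nonneg _)] at h
  simpa using h

theorem norm_schwartzToL2_mul_le {f g : 𝓢(E, ℂ)} {M : ℝ} (hM : ∀ x, ‖f x‖ ≤ M) :
    ‖schwartzToL2 (schwartzMul f g)‖ ≤ M * ‖schwartzToL2 g‖ :=
  norm_schwartzToL2_le_mul fun x => by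
    rw [schwartzMul_apply, norm_mul]
    gcongr
    exact hM x

theorem norm_schwartzToL2_mul_sq_le (f g : 𝓢(E, ℂ)) :
    ‖schwartzToL2 (schwartzMul f g)‖ ^ 2 ≤
      ‖schwartzToL2 (schwartzMul f f)‖ * ‖schwartzToL2 (schwartzMul g g)‖ := by
  refine le_trans (le_of_eq ?_) (integral_norm_mul_norm_le_norm_schwartzToL2 _ _)
  rw [norm_schwartzToL2_sq]
  congr 1 with x
  simp only [schwartzMul_apply, norm_mul]
  ring

theorem real_inner_schwartzToL2_lineDerivOp (f g : 𝓢(E, ℂ)) (v : E) :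
    ⟪schwartzToL2 (∂_{v} f), schwartzToL2 g⟫_ℝ =
      -⟪schwartzToL2 f, schwartzToL2 (∂_{v} g)⟫_ℝ := by
  have h : ∫ x, ⟪f x, ∂_{v} g x⟫_ℝ = -∫ x, ⟪∂_{v} f x, g x⟫_ℝ :=
    SchwartzMap.integral_bilinear_lineDerivOp_right_eq_neg_left (μ := volume) f g (innerSL ℝ) v
  rw [real_inner_schwartzToL2, real_inner_schwartzToL2, h, neg_neg]

theorem norm_schwartzToL2_laplacian_sq {ι : Type*} [Fintype ι] (b : OrthonormalBasis ι ℝ E)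
    (f : 𝓢(E, ℂ)) :
    ‖schwartzToL2 (Δ f)‖ ^ 2 = ∑ i, ∑ j, ‖schwartzToL2 (∂_{b i} (∂_{b j} f))‖ ^ 2 := by
  rw [← real_inner_self_eq_norm_sq, SchwartzMap.laplacian_eq_sum b, map_sum, sum_inner]
  refine Finset.sum_congr rfl fun i _ => ?_
  rw [inner_sum]
  refine Finset.sum_congr rfl fun j _ => ?_
  rw [real_inner_schwartzToL2_lineDerivOp, lineDerivOp_lineDerivOp_comm _ (b i) (b j),
    ← real_inner_schwartzToL2_lineDerivOp, lineDerivOp_lineDerivOp_comm _ (b i) (b j),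
    real_inner_self_eq_norm_sq]

theorem norm_schwartzToL2_lineDerivOp_lineDerivOp_le {ι : Type*} [Fintype ι]
    (b : OrthonormalBasis ι ℝ E) (f : 𝓢(E, ℂ)) (i j : ι) :
    ‖schwartzToL2 (∂_{b i} (∂_{b j} f))‖ ≤ ‖schwartzToL2 (Δ f)‖ := by
  refine (sq_le_sq₀ (norm_nonneg _) (norm_nonneg _)).1 ?_
  rw [norm_schwartzToL2_laplacian_sq b]
  calc ‖schwartzToL2 (∂_{b i} (∂_{b j} f))‖ ^ 2
      ≤ ∑ j, ‖schwartzToL2 (∂_{b i} (∂_{b j} f))‖ ^ 2 :=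
        Finset.single_le_sum (f := fun j => ‖schwartzToL2 (∂_{b i} (∂_{b j} f))‖ ^ 2)
          (fun _ _ => sq_nonneg _) (Finset.mem_univ j)
    _ ≤ ∑ i, ∑ j, ‖schwartzToL2 (∂_{b i} (∂_{b j} f))‖ ^ 2 :=
        Finset.single_le_sum (f := fun i => ∑ j, ‖schwartzToL2 (∂_{b i} (∂_{b j} f))‖ ^ 2)
          (fun _ _ => Finset.sum_nonneg fun _ _ => sq_nonneg _) (Finset.mem_univ i)

theorem norm_schwartzToL2_mul_self_sq (f : 𝓢(E, ℂ)) :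
    ‖schwartzToL2 (schwartzMul f f)‖ ^ 2 =
      ⟪schwartzToL2 f, schwartzToL2 (schwartzMul (schwartzMul f f) (schwartzConj f))⟫_ℝ := by
  rw [real_inner_schwartzToL2, norm_schwartzToL2_sq]
  congr 1 with x
  have h : f x * f x * starRingEnd ℂ (f x) * starRingEnd ℂ (f x) = ((‖f x‖ ^ 4 : ℝ) : ℂ) := by
    rw [mul_assoc, mul_mul_mul_comm, Complex.mul_conj, Complex.normSq_eq_norm_sq]
    push_cast
    ring
  simp only [schwartzMul_apply, schwartzConj_apply, norm_mul, Complex.inner, h, Complex.ofReal_re]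
  ring

/-- A Gagliardo–Nirenberg inequality, by integration by parts in `∫ |∂f|⁴ = ∫ ⟪∂f, (∂f)² ∂f̄⟫`. -/
theorem norm_schwartzToL2_lineDerivOp_mul_self_le (f : 𝓢(E, ℂ)) (v : E) {M : ℝ}
    (hM : ∀ x, ‖f x‖ ≤ M) :
    ‖schwartzToL2 (schwartzMul (∂_{v} f) (∂_{v} f))‖ ≤
      3 * M * ‖schwartzToL2 (∂_{v} (∂_{v} f))‖ := by
  have hM0 : 0 ≤ M := (norm_nonneg _).trans (hM 0)
  set p := ∂_{v} f with hp
  have hint : Integrable fun x => 3 * M * (‖schwartzMul p p x‖ * ‖∂_{v} p x‖) := by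
    simpa using ((schwartzMul (schwartzMul p p) (∂_{v} p)).integrable (μ := volume)).norm.const_mul
      (3 * M)
  have key : ‖schwartzToL2 (schwartzMul p p)‖ ^ 2 ≤
      3 * M * (‖schwartzToL2 (schwartzMul p p)‖ * ‖schwartzToL2 (∂_{v} p)‖) := by
    rw [norm_schwartzToL2_mul_self_sq, hp, real_inner_schwartzToL2_lineDerivOp,
      real_inner_schwartzToL2, ← integral_neg, ← hp]
    refine le_trans ?_ (mul_le_mul_of_nonneg_left
      (integral_norm_mul_norm_le_norm_schwartzToL2 (schwartzMul p p) (∂_{v} p)) (by positivity))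
    rw [← integral_const_mul]
    refine (Real.le_norm_self _).trans (norm_integral_le_of_norm_le hint (ae_of_all _ fun x => ?_))
    rw [norm_neg, mul_comm 3 M, mul_assoc M]
    exact (norm_inner_le_norm _ _).trans
      (mul_le_mul (hM x) (norm_lineDerivOp_mul_self_mul_conj_le p v x) (norm_nonneg _) hM0)
  rcases (norm_nonneg (schwartzToL2 (schwartzMul p p))).eq_or_lt with h0 | h0
  · rw [← h0]
    positivity
  · nlinarith

theorem fourier_sub_smul_laplacian_apply (f : 𝓢(E, ℂ)) (ξ : E) :
    𝓕 (f - ((2 * Real.pi) ^ 2 : ℂ)⁻¹ • Δ f) ξ = (1 + ‖ξ‖ ^ 2 : ℝ) * 𝓕 f ξ := by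
  have hΔ : 𝓕 (Δ f) ξ = -(2 * Real.pi) ^ 2 * ‖ξ‖ ^ 2 * 𝓕 f ξ := by
    have h : ((‖·‖ ^ 2 : E → ℝ)).HasTemperateGrowth := Function.hasTemperateGrowth_norm_sq E
    rw [SchwartzMap.laplacian_eq_fourierMultiplierCLM, SchwartzMap.fourierMultiplierCLM_apply,
      ← Complex.coe_smul, FourierTransform.fourier_smul, FourierTransform.fourier_fourierInv_eq,
      smul_apply, SchwartzMap.smulLeftCLM_apply_apply h]
    simp
    ring
  have : (2 * Real.pi : ℂ) ^ 2 ≠ 0 := by simp [Real.pi_ne_zero]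
  rw [sub_eq_add_neg, ← neg_smul, FourierTransform.fourier_add, FourierTransform.fourier_smul,
    add_apply, smul_apply, hΔ, smul_eq_mul]
  push_cast
  field_simp

theorem norm_schwartzToL2_sub_smul_laplacian_le (f : 𝓢(E, ℂ)) :
    ‖schwartzToL2 (f - ((2 * Real.pi) ^ 2 : ℂ)⁻¹ • Δ f)‖ ≤
      ‖schwartzToL2 f‖ + ‖schwartzToL2 (Δ f)‖ := by
  have hpi : ‖((2 * Real.pi) ^ 2 : ℂ)⁻¹‖ ≤ 1 := by
    rw [norm_inv, norm_pow, norm_mul, Complex.norm_real, Real.norm_of_nonneg Real.pi_pos.le,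
      Complex.norm_ofNat]
    exact inv_le_one_of_one_le₀ (by nlinarith [Real.pi_gt_three])
  rw [map_sub, map_smul]
  refine (norm_sub_le _ _).trans (add_le_add_right ?_ _)
  rw [norm_smul]
  exact mul_le_of_le_one_left (norm_nonneg _) hpi

theorem norm_apply_le_integral_norm_fourier (f : 𝓢(E, ℂ)) (x : E) :
    ‖f x‖ ≤ ∫ ξ, ‖𝓕 f ξ‖ := by
  have h := SchwartzMap.norm_fourier_apply_le_toLp_one (𝓕 f) (-x)
  rw [SchwartzMap.norm_toLp_one] at h
  calc ‖f x‖ = ‖𝓕⁻ (𝓕 f) x‖ := by rw [FourierTransform.fourierInv_fourier_eq]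
    _ ≤ _ := h

theorem memLp_two_inv_one_add_norm_sq (hE : Module.finrank ℝ E < 4) :
    MemLp (fun ξ : E => (1 + ‖ξ‖ ^ 2)⁻¹) 2 volume := by
  have hc : Continuous fun ξ : E => (1 + ‖ξ‖ ^ 2)⁻¹ :=
    Continuous.inv₀ (by fun_prop) fun ξ => by positivity
  rw [memLp_two_iff_integrable_sq hc.aestronglyMeasurable]
  refine (integrable_rpow_neg_one_add_norm_sq (μ := volume) (r := 4) (mod_cast hE)).congr
    (ae_of_all _ fun ξ => ?_)
  change (1 + ‖ξ‖ ^ 2) ^ (-4 / 2 : ℝ) = ((1 + ‖ξ‖ ^ 2)⁻¹) ^ 2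
  rw [show (-4 / 2 : ℝ) = -(2 : ℕ) by norm_num, Real.rpow_neg (by positivity), Real.rpow_natCast,
    inv_pow]

/-- The Sobolev embedding `H² ⊆ L^∞`, by Cauchy–Schwarz in
`∫ |𝓕 f| = ∫ (1 + |ξ|²)⁻¹ |𝓕 (f - (2π)⁻² Δ f)|`. -/
theorem exists_norm_apply_le_norm_add_norm_laplacian (hE : Module.finrank ℝ E < 4) :
    ∃ K : ℝ, 0 ≤ K ∧ ∀ (f : 𝓢(E, ℂ)) (x : E),
      ‖f x‖ ≤ K * (‖schwartzToL2 f‖ + ‖schwartzToL2 (Δ f)‖) := by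
  refine ⟨√(∫ ξ : E, ((1 + ‖ξ‖ ^ 2)⁻¹) ^ 2), Real.sqrt_nonneg _, fun f x => ?_⟩
  set g : 𝓢(E, ℂ) := f - ((2 * Real.pi) ^ 2 : ℂ)⁻¹ • Δ f
  have hfg (ξ : E) : ‖𝓕 f ξ‖ = ‖(1 + ‖ξ‖ ^ 2)⁻¹‖ * ‖𝓕 g ξ‖ := by
    rw [fourier_sub_smul_laplacian_apply, norm_mul, Complex.norm_real, norm_inv,
      inv_mul_cancel_left₀ (norm_ne_zero_iff.2 (by positivity))]
  calc ‖f x‖ ≤ ∫ ξ, ‖(1 + ‖ξ‖ ^ 2)⁻¹‖ * ‖𝓕 g ξ‖ := by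
        simpa only [← hfg] using norm_apply_le_integral_norm_fourier f x
    _ ≤ √(∫ ξ : E, ((1 + ‖ξ‖ ^ 2)⁻¹) ^ 2) * ‖schwartzToL2 (𝓕 g)‖ :=
        integral_mul_norm_le_sqrt_mul_norm_schwartzToL2 (memLp_two_inv_one_add_norm_sq hE) _
    _ = √(∫ ξ : E, ((1 + ‖ξ‖ ^ 2)⁻¹) ^ 2) * ‖schwartzToL2 g‖ := by
        rw [show ‖schwartzToL2 (𝓕 g)‖ = ‖schwartzToL2 g‖ from SchwartzMap.norm_fourier_toL2_eq g]
    _ ≤ _ := mul_le_mul_of_nonneg_left (norm_schwartzToL2_sub_smul_laplacian_le f)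
        (Real.sqrt_nonneg _)

end SchwartzL2

section Schrodinger

variable {E : Type*} [NormedAddCommGroup E] [InnerProductSpace ℝ E] [FiniteDimensional ℝ E]

/-- The Schrödinger operator `-Δ + V` on Schwartz functions; it is the intended operator when `V`
has temperate growth (otherwise the multiplication is the junk value `0`). -/
noncomputable def schrodingerCLM (V : E → ℝ) : 𝓢(E, ℂ) →L[ℂ] 𝓢(E, ℂ) :=
  -LineDeriv.laplacianCLM ℂ E 𝓢(E, ℂ) + SchwartzMap.smulLeftCLM ℂ (fun x => (V x : ℂ))

theorem schrodingerCLM_eq {V : E → ℝ} (hV : V.HasTemperateGrowth) (f : 𝓢(E, ℂ)) :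
    schrodingerCLM V f = -Δ f + SchwartzMap.smulLeftCLM ℂ V f := by
  have h : SchwartzMap.smulLeftCLM ℂ (fun x => (V x : ℂ)) f = SchwartzMap.smulLeftCLM ℂ V f :=
    SchwartzMap.smulLeftCLM_ofReal ℂ hV f
  simp [schrodingerCLM, h]

theorem laplacian_schwartzMul {ι : Type*} [Fintype ι] (b : OrthonormalBasis ι ℝ E)
    (f g : 𝓢(E, ℂ)) :
    Δ (schwartzMul f g) = schwartzMul (Δ f) g + schwartzMul f (Δ g) +
      (2 : ℂ) • ∑ j, schwartzMul (∂_{b j} f) (∂_{b j} g) := by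
  simp only [SchwartzMap.laplacian_eq_sum b, lineDerivOp_schwartzMul, LineDeriv.lineDerivOp_add]
  ext x
  simp only [sum_apply, add_apply, schwartzMul_apply, smul_apply, Finset.sum_mul,
    Finset.mul_sum, smul_eq_mul, ← Finset.sum_add_distrib]
  refine Finset.sum_congr rfl fun j _ => ?_
  ring

theorem laplacian_eq_sum_fderiv_fderiv {ι : Type*} [Fintype ι] (b : OrthonormalBasis ι ℝ E)
    {V : E → ℝ} (hV : V.HasTemperateGrowth) (x : E) :
    Δ V x = ∑ j, fderiv ℝ (fun y => fderiv ℝ V y (b j)) x (b j) := by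
  rw [InnerProductSpace.laplacian_eq_iteratedFDeriv_orthonormalBasis V b]
  refine Finset.sum_congr rfl fun j _ => ?_
  have hd : DifferentiableAt ℝ (fderiv ℝ V) x :=
    (hasTemperateGrowth_fderiv hV).1.differentiable (by simp) x
  simp [iteratedFDeriv_two_apply, fderiv_clm_apply hd (differentiableAt_const (b j))]

theorem hasTemperateGrowth_laplacian {V : E → ℝ} (hV : V.HasTemperateGrowth) :
    (Δ V).HasTemperateGrowth := by
  rw [funext (laplacian_eq_sum_fderiv_fderiv (stdOrthonormalBasis ℝ E) hV)]
  exact Function.HasTemperateGrowth.sum fun j _ =>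
    hasTemperateGrowth_fderiv_apply (hasTemperateGrowth_fderiv_apply hV _) _

variable [MeasurableSpace E] [BorelSpace E]

theorem real_inner_schwartzToL2_smulLeftCLM {V : E → ℝ} (hV : V.HasTemperateGrowth)
    (f : 𝓢(E, ℂ)) :
    ⟪schwartzToL2 f, schwartzToL2 (SchwartzMap.smulLeftCLM ℂ V f)⟫_ℝ = ∫ x, V x * ‖f x‖ ^ 2 := by
  rw [real_inner_schwartzToL2]
  congr 1 with x
  rw [SchwartzMap.smulLeftCLM_apply_apply hV, real_inner_smul_right, real_inner_self_eq_norm_sq]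

theorem integrable_mul_norm_sq {V : E → ℝ} (hV : V.HasTemperateGrowth) (f : 𝓢(E, ℂ)) :
    Integrable fun x => V x * ‖f x‖ ^ 2 := by
  have h := ((schwartzMul (schwartzConj f) (SchwartzMap.smulLeftCLM ℂ V f)).integrable
    (μ := volume)).re
  refine h.congr (ae_of_all _ fun x => ?_)
  change ((starRingEnd ℂ (f x)) * SchwartzMap.smulLeftCLM ℂ V f x).re = _
  rw [SchwartzMap.smulLeftCLM_apply_apply hV, mul_smul_comm, mul_comm, Complex.mul_conj,
    Complex.normSq_eq_norm_sq, Complex.real_smul, Complex.re_ofReal_mul, Complex.ofReal_re]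

theorem two_mul_real_inner_lineDerivOp_smulLeftCLM {V : E → ℝ} (hV : V.HasTemperateGrowth)
    (f : 𝓢(E, ℂ)) (v : E) :
    2 * ⟪schwartzToL2 (∂_{v} f), schwartzToL2 (SchwartzMap.smulLeftCLM ℂ V f)⟫_ℝ =
      -∫ x, fderiv ℝ V x v * ‖f x‖ ^ 2 := by
  have hparts := real_inner_schwartzToL2_lineDerivOp f (SchwartzMap.smulLeftCLM ℂ V f) v
  have hsymm : ⟪schwartzToL2 f, schwartzToL2 (SchwartzMap.smulLeftCLM ℂ V (∂_{v} f))⟫_ℝ =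
      ⟪schwartzToL2 (∂_{v} f), schwartzToL2 (SchwartzMap.smulLeftCLM ℂ V f)⟫_ℝ := by
    rw [real_inner_schwartzToL2, real_inner_schwartzToL2]
    congr 1 with x
    simp only [SchwartzMap.smulLeftCLM_apply_apply hV, real_inner_smul_right, real_inner_comm]
  rw [lineDerivOp_smulLeftCLM hV, map_add, inner_add_right, hsymm,
    real_inner_schwartzToL2_smulLeftCLM (hasTemperateGrowth_fderiv_apply hV v)] at hparts
  linarith

theorem real_inner_laplacian_smulLeftCLM {ι : Type*} [Fintype ι] (b : OrthonormalBasis ι ℝ E)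
    {V : E → ℝ} (hV : V.HasTemperateGrowth) (f : 𝓢(E, ℂ)) :
    ⟪schwartzToL2 (Δ f), schwartzToL2 (SchwartzMap.smulLeftCLM ℂ V f)⟫_ℝ =
      (∫ x, Δ V x * ‖f x‖ ^ 2) / 2 - ∑ j, ∫ x, V x * ‖∂_{b j} f x‖ ^ 2 := by
  have hV' (j : ι) := hasTemperateGrowth_fderiv_apply hV (b j)
  have hterm (j : ι) :
      ⟪schwartzToL2 (∂_{b j} (∂_{b j} f)), schwartzToL2 (SchwartzMap.smulLeftCLM ℂ V f)⟫_ℝ =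
        (∫ x, fderiv ℝ (fun y => fderiv ℝ V y (b j)) x (b j) * ‖f x‖ ^ 2) / 2 -
          ∫ x, V x * ‖∂_{b j} f x‖ ^ 2 := by
    have h := two_mul_real_inner_lineDerivOp_smulLeftCLM (hV' j) f (b j)
    rw [real_inner_schwartzToL2_lineDerivOp, lineDerivOp_smulLeftCLM hV, map_add, inner_add_right,
      real_inner_schwartzToL2_smulLeftCLM hV]
    linarith
  simp only [laplacian_eq_sum_fderiv_fderiv b hV, Finset.sum_mul]
  rw [integral_finsetSum _ fun j _ =>
      integrable_mul_norm_sq (hasTemperateGrowth_fderiv_apply (hV' j) (b j)) f,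
    SchwartzMap.laplacian_eq_sum b, map_sum, sum_inner, Finset.sum_congr rfl fun j _ => hterm j,
    Finset.sum_sub_distrib, Finset.sum_div]

/-- The cross term of `‖-Δf + Vf‖²` is `2 ∑ⱼ ∫ V |∂ⱼf|² - ∫ (ΔV) |f|²`, and only its last part can
be negative. -/
theorem norm_laplacian_sq_add_norm_smulLeftCLM_sq_le {V : E → ℝ} (hV : V.HasTemperateGrowth)
    (hV0 : ∀ x, 0 ≤ V x) {S : ℝ} (hS : ∀ x, Δ V x ≤ S) (f : 𝓢(E, ℂ)) :
    ‖schwartzToL2 (Δ f)‖ ^ 2 + ‖schwartzToL2 (SchwartzMap.smulLeftCLM ℂ V f)‖ ^ 2 ≤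
      ‖schwartzToL2 (schrodingerCLM V f)‖ ^ 2 + S * ‖schwartzToL2 f‖ ^ 2 := by
  have hcross : 2 * ⟪schwartzToL2 (SchwartzMap.smulLeftCLM ℂ V f), schwartzToL2 (Δ f)⟫_ℝ ≤
      S * ‖schwartzToL2 f‖ ^ 2 := by
    have hΔV : ∫ x, Δ V x * ‖f x‖ ^ 2 ≤ S * ‖schwartzToL2 f‖ ^ 2 := by
      rw [norm_schwartzToL2_sq, ← integral_const_mul]
      have hS' : (fun _ : E => S).HasTemperateGrowth := by fun_prop
      exact integral_mono (integrable_mul_norm_sq (hasTemperateGrowth_laplacian hV) f)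
        (integrable_mul_norm_sq hS' f) fun x => mul_le_mul_of_nonneg_right (hS x) (sq_nonneg _)
    have hgrad : 0 ≤ ∑ j, ∫ x, V x * ‖∂_{stdOrthonormalBasis ℝ E j} f x‖ ^ 2 :=
      Finset.sum_nonneg fun j _ => integral_nonneg fun x => mul_nonneg (hV0 x) (sq_nonneg _)
    rw [real_inner_comm, real_inner_laplacian_smulLeftCLM (stdOrthonormalBasis ℝ E) hV]
    linarith
  rw [schrodingerCLM_eq hV, neg_add_eq_sub, map_sub, norm_sub_sq_real]
  linarith

section Coercive

variable {V : E → ℝ} {S c : ℝ}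

theorem exists_norm_le_mul_norm_schrodingerCLM (hE : Module.finrank ℝ E < 4)
    (hV : V.HasTemperateGrowth) (hV0 : ∀ x, 0 ≤ V x) (hS : ∀ x, Δ V x ≤ S)
    (hc : ∀ f : 𝓢(E, ℂ), ‖schwartzToL2 f‖ ≤ c * ‖schwartzToL2 (schrodingerCLM V f)‖) :
    ∃ K : ℝ, ∀ f : 𝓢(E, ℂ),
      ‖schwartzToL2 (Δ f)‖ ≤ K * ‖schwartzToL2 (schrodingerCLM V f)‖ ∧
      ‖schwartzToL2 (SchwartzMap.smulLeftCLM ℂ V f)‖ ≤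
        K * ‖schwartzToL2 (schrodingerCLM V f)‖ ∧
      ∀ x, ‖f x‖ ≤ K * ‖schwartzToL2 (schrodingerCLM V f)‖ := by
  obtain ⟨K₀, hK₀, hsob⟩ := exists_norm_apply_le_norm_add_norm_laplacian hE
  set κ := √(1 + |S| * c ^ 2)
  have hκ2 : κ ^ 2 = 1 + |S| * c ^ 2 := Real.sq_sqrt (by positivity)
  refine ⟨max κ (K₀ * (c + κ)), fun f => ?_⟩
  set N := ‖schwartzToL2 (schrodingerCLM V f)‖
  have hN : 0 ≤ N := norm_nonneg _
  have hgraph : ‖schwartzToL2 (Δ f)‖ ^ 2 +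
      ‖schwartzToL2 (SchwartzMap.smulLeftCLM ℂ V f)‖ ^ 2 ≤ (κ * N) ^ 2 :=
    calc _ ≤ N ^ 2 + S * ‖schwartzToL2 f‖ ^ 2 :=
          norm_laplacian_sq_add_norm_smulLeftCLM_sq_le hV hV0 hS f
      _ ≤ N ^ 2 + |S| * (c * N) ^ 2 := by
          gcongr
          exacts [le_abs_self S, hc f]
      _ = (κ * N) ^ 2 := by
          rw [mul_pow, mul_pow, hκ2]
          ring
  have hΔ : ‖schwartzToL2 (Δ f)‖ ≤ κ * N :=
    le_of_sq_le_sq ((le_add_of_nonneg_right (sq_nonneg _)).trans hgraph) (by positivity)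
  have hVf : ‖schwartzToL2 (SchwartzMap.smulLeftCLM ℂ V f)‖ ≤ κ * N :=
    le_of_sq_le_sq ((le_add_of_nonneg_left (sq_nonneg _)).trans hgraph) (by positivity)
  have hsup (x : E) : ‖f x‖ ≤ K₀ * (c + κ) * N := by
    rw [mul_assoc, add_mul]
    exact (hsob f x).trans (mul_le_mul_of_nonneg_left (add_le_add (hc f) hΔ) hK₀)
  have hκ_le := mul_le_mul_of_nonneg_right (le_max_left κ (K₀ * (c + κ))) hN
  exact ⟨hΔ.trans hκ_le, hVf.trans hκ_le,
    fun x => (hsup x).trans (mul_le_mul_of_nonneg_right (le_max_right _ _) hN)⟩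

theorem norm_schwartzToL2_lineDerivOp_mul_lineDerivOp_le {ι : Type*} [Fintype ι]
    (b : OrthonormalBasis ι ℝ E) {f g : 𝓢(E, ℂ)} {m n : ℝ}
    (hf : ∀ x, ‖f x‖ ≤ m) (hΔf : ‖schwartzToL2 (Δ f)‖ ≤ m)
    (hg : ∀ x, ‖g x‖ ≤ n) (hΔg : ‖schwartzToL2 (Δ g)‖ ≤ n) (j : ι) :
    ‖schwartzToL2 (schwartzMul (∂_{b j} f) (∂_{b j} g))‖ ≤ 3 * m * n := by
  have hself {h : 𝓢(E, ℂ)} {r : ℝ} (hh : ∀ x, ‖h x‖ ≤ r) (hΔh : ‖schwartzToL2 (Δ h)‖ ≤ r) :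
      ‖schwartzToL2 (schwartzMul (∂_{b j} h) (∂_{b j} h))‖ ≤ 3 * r * r := by
    have hr : 0 ≤ r := (norm_nonneg _).trans hΔh
    exact (norm_schwartzToL2_lineDerivOp_mul_self_le h (b j) hh).trans (mul_le_mul_of_nonneg_left
      ((norm_schwartzToL2_lineDerivOp_lineDerivOp_le b h j j).trans hΔh) (by positivity))
  have hm : 0 ≤ m := (norm_nonneg _).trans hΔf
  have hn : 0 ≤ n := (norm_nonneg _).trans hΔg
  refine le_of_sq_le_sq ?_ (by positivity)
  calc ‖schwartzToL2 (schwartzMul (∂_{b j} f) (∂_{b j} g))‖ ^ 2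
      ≤ ‖schwartzToL2 (schwartzMul (∂_{b j} f) (∂_{b j} f))‖ *
          ‖schwartzToL2 (schwartzMul (∂_{b j} g) (∂_{b j} g))‖ := norm_schwartzToL2_mul_sq_le _ _
    _ ≤ (3 * m * m) * (3 * n * n) := by
        gcongr
        exacts [hself hf hΔf, hself hg hΔg]
    _ = (3 * m * n) ^ 2 := by ring

theorem exists_norm_schrodingerCLM_schwartzMul_le (hE : Module.finrank ℝ E < 4)
    (hV : V.HasTemperateGrowth) (hV0 : ∀ x, 0 ≤ V x) (hS : ∀ x, Δ V x ≤ S)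
    (hc : ∀ f : 𝓢(E, ℂ), ‖schwartzToL2 f‖ ≤ c * ‖schwartzToL2 (schrodingerCLM V f)‖) :
    ∃ C : ℝ, 0 < C ∧ ∀ f g : 𝓢(E, ℂ),
      ‖schwartzToL2 (schrodingerCLM V (schwartzMul f g))‖ ≤
        C * ‖schwartzToL2 (schrodingerCLM V f)‖ * ‖schwartzToL2 (schrodingerCLM V g)‖ := by
  obtain ⟨K, hbound⟩ := exists_norm_le_mul_norm_schrodingerCLM hE hV hV0 hS hc
  set b := stdOrthonormalBasis ℝ E
  refine ⟨(3 + 6 * Module.finrank ℝ E) * K ^ 2 + 1, by positivity, fun f g => ?_⟩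
  set p := ‖schwartzToL2 (schrodingerCLM V f)‖
  set q := ‖schwartzToL2 (schrodingerCLM V g)‖
  obtain ⟨hΔf, hVf, hf⟩ := hbound f
  obtain ⟨hΔg, -, hg⟩ := hbound g
  have hp : 0 ≤ p := norm_nonneg _
  have hq : 0 ≤ q := norm_nonneg _
  have hmul {h k : 𝓢(E, ℂ)} {m n : ℝ} (hh : ∀ x, ‖h x‖ ≤ m) (hk : ‖schwartzToL2 k‖ ≤ n) :
      ‖schwartzToL2 (schwartzMul h k)‖ ≤ m * n :=
    (norm_schwartzToL2_mul_le hh).trans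
      (mul_le_mul_of_nonneg_left hk ((norm_nonneg _).trans (hh 0)))
  have hΔ : ‖schwartzToL2 (Δ (schwartzMul f g))‖ ≤ K * q * (K * p) + K * p * (K * q) +
      2 * (Module.finrank ℝ E * (3 * (K * p) * (K * q))) := by
    rw [laplacian_schwartzMul b, map_add, map_add, map_smul, map_sum, schwartzMul_comm (Δ f)]
    refine (norm_add₃_le.trans (add_le_add_three (hmul hg hΔf) (hmul hf hΔg) ?_))
    rw [norm_smul, Complex.norm_ofNat]
    refine mul_le_mul_of_nonneg_left ((norm_sum_le_of_le _ fun j _ =>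
      norm_schwartzToL2_lineDerivOp_mul_lineDerivOp_le b hf hΔf hg hΔg j).trans ?_) zero_le_two
    rw [Finset.sum_const, Finset.card_univ, Fintype.card_fin, nsmul_eq_mul]
  have hVfg : ‖schwartzToL2 (SchwartzMap.smulLeftCLM ℂ V (schwartzMul f g))‖ ≤
      K * q * (K * p) := by
    rw [smulLeftCLM_schwartzMul hV, schwartzMul_comm]
    exact hmul hg hVf
  rw [schrodingerCLM_eq hV, map_add, map_neg]
  refine (norm_add_le _ _).trans ?_
  rw [norm_neg]
  nlinarith [mul_nonneg hp hq]

end Coercive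

end Schrodinger

section GaussianDecay

theorem one_add_pow_mul_exp_neg_mul_sq_le (N : ℕ) {c : ℝ} (hc : 0 < c) {t : ℝ} (ht : 0 ≤ t) :
    (1 + t) ^ N * Real.exp (-(c * t ^ 2)) ≤ N.factorial * Real.exp (1 + 1 / (4 * c)) := by
  have hpow : (1 + t) ^ N ≤ N.factorial * Real.exp (1 + t) := by
    rw [← div_le_iff₀' (by positivity)]
    exact Real.pow_div_factorial_le_exp (1 + t) (by positivity) N
  have hsq : 1 + t + -(c * t ^ 2) ≤ 1 + 1 / (4 * c) := by
    have hgap : 1 / (4 * c) - t + c * t ^ 2 = (2 * c * t - 1) ^ 2 / (4 * c) := by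
      field_simp
      ring
    linarith [show 0 ≤ (2 * c * t - 1) ^ 2 / (4 * c) by positivity]
  calc (1 + t) ^ N * Real.exp (-(c * t ^ 2))
      ≤ N.factorial * Real.exp (1 + t) * Real.exp (-(c * t ^ 2)) := by gcongr
    _ = N.factorial * Real.exp (1 + t + -(c * t ^ 2)) := by rw [Real.exp_add (1 + t), mul_assoc]
    _ ≤ N.factorial * Real.exp (1 + 1 / (4 * c)) := by gcongr

variable {E : Type*} [NormedAddCommGroup E] [NormedSpace ℝ E] {q : E → ℝ}

theorem exists_norm_iteratedFDeriv_exp_neg_le (hq : q.HasTemperateGrowth) (n : ℕ) :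
    ∃ (m : ℕ) (C : ℝ), 0 ≤ C ∧ ∀ x, ‖iteratedFDeriv ℝ n (fun x => Real.exp (-q x)) x‖ ≤
      C * (1 + ‖x‖) ^ m * Real.exp (-q x) := by
  obtain ⟨m, C, hC, hbound⟩ := hq.neg.norm_iteratedFDeriv_le_uniform n
  refine ⟨m * n, n.factorial * (1 + C) ^ n, by positivity, fun x => ?_⟩
  have hexp (i : ℕ) : ‖iteratedFDeriv ℝ i Real.exp (-q x)‖ ≤ Real.exp (-q x) := by
    rw [norm_iteratedFDeriv_eq_norm_iteratedDeriv, iteratedDeriv_eq_iterate, Real.iter_deriv_exp,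
      Real.norm_of_nonneg (Real.exp_pos _).le]
  have hpow (i : ℕ) (hi : 1 ≤ i) (hin : i ≤ n) :
      ‖iteratedFDeriv ℝ i (-q) x‖ ≤ ((1 + C) * (1 + ‖x‖) ^ m) ^ i := by
    have hone : 1 ≤ (1 + ‖x‖) ^ m := one_le_pow₀ (by linarith [norm_nonneg x])
    calc ‖iteratedFDeriv ℝ i (-q) x‖ ≤ C * (1 + ‖x‖) ^ m := hbound i hin x
      _ ≤ (1 + C) * (1 + ‖x‖) ^ m := by gcongr; linarith
      _ ≤ ((1 + C) * (1 + ‖x‖) ^ m) ^ i := le_self_pow₀ (by nlinarith) (by lia)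
  refine (norm_iteratedFDeriv_comp_le (N := n) Real.contDiff_exp
    (hq.neg.1.of_le (mod_cast le_top)) le_rfl x (fun i _ => hexp i) hpow).trans_eq ?_
  rw [mul_pow, ← pow_mul]
  ring

theorem exists_pow_mul_norm_iteratedFDeriv_exp_neg_le (hq : q.HasTemperateGrowth)
    (hqc : ∃ c, 0 < c ∧ ∀ x, c * ‖x‖ ^ 2 ≤ q x) (k n : ℕ) :
    ∃ C : ℝ, ∀ x, ‖x‖ ^ k * ‖iteratedFDeriv ℝ n (fun x => Real.exp (-q x)) x‖ ≤ C := by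
  obtain ⟨c, hc, hcq⟩ := hqc
  obtain ⟨m, C, hC, hbound⟩ := exists_norm_iteratedFDeriv_exp_neg_le hq n
  refine ⟨C * ((k + m).factorial * Real.exp (1 + 1 / (4 * c))), fun x => ?_⟩
  calc ‖x‖ ^ k * ‖iteratedFDeriv ℝ n (fun x => Real.exp (-q x)) x‖
      ≤ (1 + ‖x‖) ^ k * (C * (1 + ‖x‖) ^ m * Real.exp (-(c * ‖x‖ ^ 2))) := by
        gcongr
        · linarith
        · exact (hbound x).trans (by gcongr; exact hcq x)
    _ = C * ((1 + ‖x‖) ^ (k + m) * Real.exp (-(c * ‖x‖ ^ 2))) := by ring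
    _ ≤ C * ((k + m).factorial * Real.exp (1 + 1 / (4 * c))) :=
        mul_le_mul_of_nonneg_left (one_add_pow_mul_exp_neg_mul_sq_le _ hc (norm_nonneg x)) hC

/-- The Schwartz function `e^{-q}`, for a function `q` of temperate growth that is bounded below
by a positive multiple of `‖x‖²`. -/
noncomputable def schwartzExpNeg (hq : q.HasTemperateGrowth)
    (hqc : ∃ c, 0 < c ∧ ∀ x, c * ‖x‖ ^ 2 ≤ q x) : 𝓢(E, ℂ) :=
  SchwartzMap.postcompCLM Complex.ofRealCLM
    { toFun := fun x => Real.exp (-q x)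
      smooth' := Real.contDiff_exp.comp hq.1.neg
      decay' := exists_pow_mul_norm_iteratedFDeriv_exp_neg_le hq hqc }

@[simp]
theorem schwartzExpNeg_apply (hq : q.HasTemperateGrowth)
    (hqc : ∃ c, 0 < c ∧ ∀ x, c * ‖x‖ ^ 2 ≤ q x) (x : E) :
    schwartzExpNeg hq hqc x = Real.exp (-q x) :=
  rfl

theorem hasTemperateGrowth_finsetProd {ι : Type*} {f : ι → E → ℝ} (s : Finset ι)
    (hf : ∀ i ∈ s, (f i).HasTemperateGrowth) : (fun x => ∏ i ∈ s, f i x).HasTemperateGrowth := by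
  classical
  induction s using Finset.induction_on with
  | empty => simp
  | insert a s ha ih =>
    simp only [Finset.prod_insert ha]
    exact (hf a (Finset.mem_insert_self a s)).mul
      (ih fun i hi => hf i (Finset.mem_insert_of_mem hi))

theorem hasTemperateGrowth_aeval {R : Type*} [CommSemiring R] [Algebra R ℝ]
    (hq : q.HasTemperateGrowth) (p : Polynomial R) :
    (fun x => Polynomial.aeval (q x) p).HasTemperateGrowth := by
  induction p using Polynomial.induction_on' with
  | add p q hp hq =>
    simp only [map_add]
    exact hp.add hq
  | monomial n a =>
    simp only [Polynomial.aeval_monomial]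
    fun_prop

end GaussianDecay

section Hermite

open Polynomial

theorem derivative_hermite_succ (n : ℕ) :
    derivative (hermite (n + 1)) = (n + 1 : ℤ[X]) * hermite n := by
  induction n with
  | zero => simp
  | succ n ih =>
    rw [hermite_succ (n + 1), derivative_sub, derivative_mul, ih, derivative_mul]
    simp only [derivative_X, derivative_add, derivative_one, derivative_natCast]
    push_cast
    linear_combination (-(n + 1 : ℤ[X])) * hermite_succ n

theorem hermite_differential_equation (n : ℕ) :
    derivative (derivative (hermite n)) - X * derivative (hermite n) + (n : ℤ[X]) * hermite n =
      0 := by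
  cases n with
  | zero => simp
  | succ n =>
    rw [derivative_hermite_succ, derivative_mul]
    simp only [derivative_add, derivative_one, derivative_natCast]
    push_cast
    linear_combination (n + 1 : ℤ[X]) * hermite_succ n

theorem hasDerivAt_aeval_sqrt_two_mul_mul_exp (p : ℤ[X]) (x : ℝ) :
    HasDerivAt (fun x : ℝ => aeval (√2 * x) p * Real.exp (-(x ^ 2) / 2))
      ((√2)⁻¹ * (aeval (√2 * x) (2 * derivative p - X * p) * Real.exp (-(x ^ 2) / 2))) x := by
  have hp := (Polynomial.hasDerivAt_aeval p (√2 * x)).comp x ((hasDerivAt_id x).const_mul √2)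
  refine (hp.mul ((hasDerivAt_pow 2 x).neg.div_const 2).exp).congr_deriv ?_
  simp only [map_sub, map_mul, map_ofNat, aeval_X, Function.comp_apply, Pi.neg_apply]
  field_simp
  push_cast
  linear_combination 2 * aeval (√2 * x) (derivative p) *
    Real.sq_sqrt (zero_le_two (α := ℝ))

theorem hasDerivAt_hermiteFunction (n : ℕ) (x : ℝ) :
    HasDerivAt (hermiteFunction n) ((√((n.factorial : ℝ) * √Real.pi))⁻¹ * ((√2)⁻¹ *
      (aeval (√2 * x) (2 * derivative (hermite n) - X * hermite n) *
        Real.exp (-(x ^ 2) / 2)))) x :=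
  (hasDerivAt_aeval_sqrt_two_mul_mul_exp (hermite n) x).const_mul _

theorem hasDerivAt_deriv_hermiteFunction (n : ℕ) (x : ℝ) :
    HasDerivAt (deriv (hermiteFunction n)) ((x ^ 2 - (2 * n + 1)) * hermiteFunction n x) x := by
  rw [show deriv (hermiteFunction n) = _ from
    funext fun y => (hasDerivAt_hermiteFunction n y).deriv]
  refine (((hasDerivAt_aeval_sqrt_two_mul_mul_exp _ x).const_mul _).const_mul _).congr_deriv ?_
  have hode : 2 * derivative (2 * derivative (hermite n) - X * hermite n) -
      X * (2 * derivative (hermite n) - X * hermite n) =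
      (X ^ 2 - 2 * (2 * (n : ℤ[X]) + 1)) * hermite n := by
    simp only [derivative_sub, derivative_mul, derivative_ofNat, derivative_X]
    linear_combination 4 * hermite_differential_equation n
  have hsq : (√2)⁻¹ * (√2)⁻¹ = (2 : ℝ)⁻¹ := by rw [← mul_inv, Real.mul_self_sqrt zero_le_two]
  have hx : (√2 * x) ^ 2 = 2 * x ^ 2 := by rw [mul_pow, Real.sq_sqrt zero_le_two]
  rw [hode, hermiteFunction]
  simp only [map_sub, map_mul, map_add, map_pow, map_ofNat, map_natCast, map_one, aeval_X, hx]
  linear_combination (√((n.factorial : ℝ) * √Real.pi))⁻¹ * (2 * x ^ 2 - 2 * (2 * n + 1)) *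
    aeval (√2 * x) (hermite n) * Real.exp (-(x ^ 2) / 2) * hsq

theorem hasDerivAt_aeval_mul_exp_neg_sq_div_two (p : ℤ[X]) (x : ℝ) :
    HasDerivAt (fun x : ℝ => aeval x p * Real.exp (-(x ^ 2) / 2))
      (aeval x (derivative p - X * p) * Real.exp (-(x ^ 2) / 2)) x := by
  refine ((Polynomial.hasDerivAt_aeval p x).mul
    ((hasDerivAt_pow 2 x).neg.div_const 2).exp).congr_deriv ?_
  simp
  ring

theorem integrable_aeval_mul_exp_neg_sq_div_two (p : ℤ[X]) :
    Integrable (fun x : ℝ => aeval x p * Real.exp (-(x ^ 2) / 2)) := by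
  induction p using Polynomial.induction_on' with
  | add p q hp hq =>
    simp only [map_add, add_mul]
    exact hp.add hq
  | monomial n a =>
    have h := (integrable_rpow_mul_exp_neg_mul_sq (b := 1 / 2) (by norm_num)
      (s := n) (by linarith [n.cast_nonneg (α := ℝ)])).const_mul (a : ℝ)
    refine h.congr (ae_of_all _ fun x => ?_)
    simp [mul_assoc, div_eq_inv_mul]

theorem integral_mul_hermite_succ (p : ℤ[X]) (n : ℕ) :
    ∫ x : ℝ, aeval x (p * hermite (n + 1)) * Real.exp (-(x ^ 2) / 2) =
      ∫ x : ℝ, aeval x (derivative p * hermite n) * Real.exp (-(x ^ 2) / 2) := by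
  have hint := integrable_aeval_mul_exp_neg_sq_div_two
  have hderiv : derivative (p * hermite n) - X * (p * hermite n) =
      derivative p * hermite n - p * hermite (n + 1) := by
    rw [hermite_succ, derivative_mul]
    ring
  have hzero := integral_eq_zero_of_hasDerivAt_of_integrable
    (hasDerivAt_aeval_mul_exp_neg_sq_div_two (p * hermite n)) (hint _) (hint _)
  simp only [hderiv, map_sub, sub_mul] at hzero
  rw [integral_sub (hint _) (hint _), sub_eq_zero] at hzero
  exact hzero.symm

theorem integral_hermite_mul_hermite (m n : ℕ) :
    ∫ x : ℝ, aeval x (hermite m * hermite n) * Real.exp (-(x ^ 2) / 2) =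
      if m = n then (n.factorial : ℝ) * √(2 * Real.pi) else 0 := by
  induction n generalizing m with
  | zero =>
    cases m with
    | zero =>
      have hgauss := integral_gaussian (1 / 2)
      rw [show Real.pi / (1 / 2) = 2 * Real.pi by ring] at hgauss
      simp [← hgauss, div_eq_inv_mul]
    | succ m =>
      rw [mul_comm, integral_mul_hermite_succ]
      simp
  | succ n ih =>
    rw [integral_mul_hermite_succ]
    cases m with
    | zero => simp
    | succ m =>
      have hsucc (x : ℝ) : aeval x (derivative (hermite (m + 1)) * hermite n) *
          Real.exp (-(x ^ 2) / 2) =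
          (m + 1) * (aeval x (hermite m * hermite n) * Real.exp (-(x ^ 2) / 2)) := by
        rw [derivative_hermite_succ]
        simp [mul_assoc]
      simp only [hsucc]
      rw [integral_const_mul, ih]
      by_cases hmn : m = n
      · simp [hmn, Nat.factorial_succ, mul_assoc]
      · simp [hmn]

theorem hermiteFunction_mul_hermiteFunction (m n : ℕ) (x : ℝ) :
    hermiteFunction m x * hermiteFunction n x =
      (√(m.factorial * √Real.pi))⁻¹ * (√(n.factorial * √Real.pi))⁻¹ *
        (aeval (√2 * x) (hermite m * hermite n) * Real.exp (-((√2 * x) ^ 2) / 2)) := by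
  have hexp : Real.exp (-((√2 * x) ^ 2) / 2) =
      Real.exp (-(x ^ 2) / 2) * Real.exp (-(x ^ 2) / 2) := by
    rw [← Real.exp_add, mul_pow, Real.sq_sqrt zero_le_two]
    ring_nf
  rw [hermiteFunction, hermiteFunction, hexp, map_mul]
  ring

theorem integral_hermiteFunction_mul_hermiteFunction (m n : ℕ) :
    ∫ x : ℝ, hermiteFunction m x * hermiteFunction n x = if m = n then 1 else 0 := by
  simp only [hermiteFunction_mul_hermiteFunction]
  rw [integral_const_mul, Measure.integral_comp_mul_left
    (fun y => aeval y (hermite m * hermite n) * Real.exp (-(y ^ 2) / 2)),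
    integral_hermite_mul_hermite]
  by_cases hmn : m = n
  · subst hmn
    have : (0 : ℝ) < m.factorial := by positivity
    have := Real.pi_pos
    rw [if_pos rfl, if_pos rfl, ← mul_inv, Real.mul_self_sqrt (by positivity),
      Real.sqrt_mul zero_le_two, abs_of_nonneg (by positivity), smul_eq_mul]
    field_simp
  · simp [hmn]

end Hermite

section TrapPotential

variable {d : ℕ}

theorem hasTemperateGrowth_euclideanSpace_apply (j : Fin d) :
    (fun x : EuclideanSpace ℝ (Fin d) => x j).HasTemperateGrowth :=
  (EuclideanSpace.proj (𝕜 := ℝ) j).hasTemperateGrowth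

theorem hasTemperateGrowth_real_trapPotential (ω : Fin d → ℝ) :
    (trapPotential ω).HasTemperateGrowth := by
  have := hasTemperateGrowth_euclideanSpace_apply (d := d)
  unfold trapPotential
  fun_prop

theorem trapPotential_nonneg (ω : Fin d → ℝ) (x : EuclideanSpace ℝ (Fin d)) :
    0 ≤ trapPotential ω x :=
  Finset.sum_nonneg fun j _ => by positivity

theorem fderiv_trapPotential_basisFun (ω : Fin d → ℝ) (j : Fin d)
    (x : EuclideanSpace ℝ (Fin d)) :
    fderiv ℝ (trapPotential ω) x (EuclideanSpace.basisFun (Fin d) ℝ j) = 2 * ω j ^ 2 * x j := by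
  have hcoord (i : Fin d) := (EuclideanSpace.proj (𝕜 := ℝ) i).hasFDerivAt (x := x)
  have h := (HasFDerivAt.fun_sum (u := Finset.univ) fun i _ =>
    ((hcoord i).pow 2).const_mul (ω i ^ 2)).fderiv
  unfold trapPotential
  refine (congrArg (· (EuclideanSpace.basisFun (Fin d) ℝ j)) h).trans ?_
  simp
  ring

theorem laplacian_trapPotential (ω : Fin d → ℝ) (x : EuclideanSpace ℝ (Fin d)) :
    Δ (trapPotential ω) x = 2 * ∑ j, ω j ^ 2 := by
  rw [laplacian_eq_sum_fderiv_fderiv (EuclideanSpace.basisFun (Fin d) ℝ)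
    (hasTemperateGrowth_real_trapPotential ω), Finset.mul_sum]
  refine Finset.sum_congr rfl fun j _ => ?_
  simp only [fderiv_trapPotential_basisFun]
  have h := (((EuclideanSpace.proj (𝕜 := ℝ) j).hasFDerivAt (x := x)).const_mul (2 * ω j ^ 2)).fderiv
  refine (congrArg (· (EuclideanSpace.basisFun (Fin d) ℝ j)) h).trans ?_
  simp

end TrapPotential

section ScaledHermite

open Polynomial

variable {ω : ℝ}

/-- The `n`-th normalised eigenfunction `ω^{1/4} φₙ(√ω y)` of the one-dimensional oscillator
`-d²/dy² + ω² y²`. -/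
noncomputable def scaledHermiteFunction (ω : ℝ) (n : ℕ) (y : ℝ) : ℝ :=
  ω ^ (1 / 4 : ℝ) * hermiteFunction n (√ω * y)

theorem hasDerivAt_scaledHermiteFunction (ω : ℝ) (n : ℕ) (y : ℝ) :
    HasDerivAt (scaledHermiteFunction ω n)
      (ω ^ (1 / 4 : ℝ) * (deriv (hermiteFunction n) (√ω * y) * √ω)) y := by
  have h := (hasDerivAt_hermiteFunction n (√ω * y)).differentiableAt.hasDerivAt
  exact ((h.comp y ((hasDerivAt_id y).const_mul √ω)).const_mul _).congr_deriv (by ring)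

theorem hasDerivAt_deriv_scaledHermiteFunction (hω : 0 ≤ ω) (n : ℕ) (y : ℝ) :
    HasDerivAt (deriv (scaledHermiteFunction ω n))
      ((ω ^ 2 * y ^ 2 - ω * (2 * n + 1)) * scaledHermiteFunction ω n y) y := by
  rw [show deriv (scaledHermiteFunction ω n) = _ from
    funext fun y => (hasDerivAt_scaledHermiteFunction ω n y).deriv]
  have h := hasDerivAt_deriv_hermiteFunction n (√ω * y)
  refine (((h.comp y ((hasDerivAt_id y).const_mul √ω)).mul_const √ω).const_mul
    (ω ^ (1 / 4 : ℝ))).congr_deriv ?_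
  rw [scaledHermiteFunction]
  linear_combination ω ^ (1 / 4 : ℝ) * hermiteFunction n (√ω * y) *
    ((√ω ^ 2 + ω) * y ^ 2 - (2 * n + 1)) * Real.sq_sqrt hω

theorem integral_scaledHermiteFunction_mul_scaledHermiteFunction (hω : 0 < ω) (m n : ℕ) :
    ∫ y, scaledHermiteFunction ω m y * scaledHermiteFunction ω n y = if m = n then 1 else 0 := by
  have hfactor (y : ℝ) : scaledHermiteFunction ω m y * scaledHermiteFunction ω n y =
      √ω * (hermiteFunction m (√ω * y) * hermiteFunction n (√ω * y)) := by
    have hsqrt : ω ^ (1 / 4 : ℝ) * ω ^ (1 / 4 : ℝ) = √ω := by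
      rw [← Real.rpow_add hω, Real.sqrt_eq_rpow]
      norm_num
    simp only [scaledHermiteFunction, ← hsqrt]
    ring
  have hs := Real.sqrt_pos.2 hω
  simp only [hfactor]
  rw [integral_const_mul, Measure.integral_comp_mul_left
    (fun y => hermiteFunction m y * hermiteFunction n y),
    integral_hermiteFunction_mul_hermiteFunction, abs_of_pos (inv_pos.2 hs), smul_eq_mul,
    mul_inv_cancel_left₀ hs.ne']

theorem scaledHermiteFunction_eq (hω : 0 ≤ ω) (n : ℕ) (y : ℝ) :
    scaledHermiteFunction ω n y = Real.exp (-(ω / 2 * y ^ 2)) *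
      (ω ^ (1 / 4 : ℝ) * (√(n.factorial * √Real.pi))⁻¹ * aeval (√(2 * ω) * y) (hermite n)) := by
  rw [scaledHermiteFunction, hermiteFunction, mul_pow, Real.sq_sqrt hω, Real.sqrt_mul zero_le_two,
    mul_assoc √2, show -(ω * y ^ 2) / 2 = -(ω / 2 * y ^ 2) by ring]
  ring

end ScaledHermite

section Eigenfunctions

open Polynomial

theorem lineDerivOp_lineDerivOp_eq_deriv_deriv {E F : Type*} [NormedAddCommGroup E]
    [NormedSpace ℝ E] [NormedAddCommGroup F] [NormedSpace ℝ F] (f : 𝓢(E, F)) (v x : E) :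
    ∂_{v} (∂_{v} f) x = deriv (deriv fun t : ℝ => f (x + t • v)) 0 := by
  have hderiv (s : ℝ) : deriv (fun t : ℝ => f (x + t • v)) s = ∂_{v} f (x + s • v) := by
    rw [SchwartzMap.lineDerivOp_apply, lineDeriv, ← zero_add s, ← deriv_comp_add_const]
    simp [add_smul, add_assoc, add_comm]
  rw [SchwartzMap.lineDerivOp_apply, lineDeriv, funext hderiv]

theorem integral_euclideanSpace_prod_eq_prod {d : ℕ} (f : Fin d → ℝ → ℝ) :
    ∫ x : EuclideanSpace ℝ (Fin d), ∏ j, f j (x j) = ∏ j, ∫ y, f j y :=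
  ((PiLp.volume_preserving_ofLp (Fin d)).integral_comp
    (MeasurableEquiv.toLp 2 (Fin d → ℝ)).symm.measurableEmbedding
    fun x => ∏ j, f j (x j)).trans (integral_fintype_prod_volume_eq_prod f)

variable {d : ℕ} {ω : Fin d → ℝ}

/-- The exponent `∑ⱼ ωⱼ xⱼ² / 2` of the ground state of `-Δ + Ω`. -/
noncomputable def groundExponent (ω : Fin d → ℝ) (x : EuclideanSpace ℝ (Fin d)) : ℝ :=
  ∑ j, ω j / 2 * x j ^ 2

theorem hasTemperateGrowth_groundExponent (ω : Fin d → ℝ) :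
    (groundExponent ω).HasTemperateGrowth := by
  have := hasTemperateGrowth_euclideanSpace_apply (d := d)
  unfold groundExponent
  fun_prop

theorem exists_mul_norm_sq_le_groundExponent (hω : ∀ j, 0 < ω j) :
    ∃ c, 0 < c ∧ ∀ x, c * ‖x‖ ^ 2 ≤ groundExponent ω x := by
  have hsum : 0 ≤ ∑ j, (ω j)⁻¹ := Finset.sum_nonneg fun j _ => (inv_pos.2 (hω j)).le
  refine ⟨(1 + ∑ j, (ω j)⁻¹)⁻¹ / 2, by positivity, fun x => ?_⟩
  rw [EuclideanSpace.norm_sq_eq, Finset.mul_sum, groundExponent]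
  refine Finset.sum_le_sum fun j _ => ?_
  rw [Real.norm_eq_abs, sq_abs]
  gcongr
  rw [inv_le_comm₀ (by positivity) (hω j)]
  have := Finset.single_le_sum (f := fun j => (ω j)⁻¹)
    (fun i _ => (inv_pos.2 (hω i)).le) (Finset.mem_univ j)
  linarith

/-- The polynomial factor of the eigenfunction `φ_k`, whose other factor is the exponential
of `-groundExponent ω`. -/
noncomputable def oscillatorPolynomial (ω : Fin d → ℝ) (k : Fin d → ℕ)
    (x : EuclideanSpace ℝ (Fin d)) : ℝ :=
  ∏ j, ω j ^ (1 / 4 : ℝ) * (√((k j).factorial * √Real.pi))⁻¹ *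
    aeval (√(2 * ω j) * x j) (hermite (k j))

theorem hasTemperateGrowth_oscillatorPolynomial (ω : Fin d → ℝ) (k : Fin d → ℕ) :
    (oscillatorPolynomial ω k).HasTemperateGrowth := by
  refine hasTemperateGrowth_finsetProd _ fun j _ => ?_
  have hcoord := hasTemperateGrowth_euclideanSpace_apply j
  have haeval := hasTemperateGrowth_aeval
    (show (fun x : EuclideanSpace ℝ (Fin d) => √(2 * ω j) * x j).HasTemperateGrowth by fun_prop)
    (hermite (k j))
  fun_prop

theorem oscillatorEigenfunction_eq_prod (ω : Fin d → ℝ) (k : Fin d → ℕ)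
    (x : EuclideanSpace ℝ (Fin d)) :
    oscillatorEigenfunction ω k x = ∏ j, scaledHermiteFunction (ω j) (k j) (x j) :=
  rfl

theorem oscillatorEigenfunction_eq_exp_mul (hω : ∀ j, 0 < ω j) (k : Fin d → ℕ)
    (x : EuclideanSpace ℝ (Fin d)) :
    oscillatorEigenfunction ω k x =
      Real.exp (-groundExponent ω x) * oscillatorPolynomial ω k x := by
  simp only [oscillatorEigenfunction_eq_prod, scaledHermiteFunction_eq (hω _).le,
    Finset.prod_mul_distrib, ← Real.exp_sum, Finset.sum_neg_distrib, groundExponent,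
    oscillatorPolynomial]

/-- The ground state `x ↦ exp (-∑ⱼ ωⱼ xⱼ² / 2)`, not normalised, as a Schwartz function. -/
noncomputable def groundState (hω : ∀ j, 0 < ω j) : 𝓢(EuclideanSpace ℝ (Fin d), ℂ) :=
  schwartzExpNeg (hasTemperateGrowth_groundExponent ω) (exists_mul_norm_sq_le_groundExponent hω)

/-- The eigenfunction `φ_k` of `-Δ + Ω` as a Schwartz function. -/
noncomputable def oscillatorEigenSchwartz (hω : ∀ j, 0 < ω j) (k : Fin d → ℕ) :
    𝓢(EuclideanSpace ℝ (Fin d), ℂ) :=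
  SchwartzMap.smulLeftCLM ℂ (oscillatorPolynomial ω k) (groundState hω)

@[simp]
theorem oscillatorEigenSchwartz_apply (hω : ∀ j, 0 < ω j) (k : Fin d → ℕ)
    (x : EuclideanSpace ℝ (Fin d)) :
    oscillatorEigenSchwartz hω k x = oscillatorEigenfunction ω k x := by
  rw [oscillatorEigenfunction_eq_exp_mul hω, oscillatorEigenSchwartz,
    SchwartzMap.smulLeftCLM_apply_apply (hasTemperateGrowth_oscillatorPolynomial ω k), groundState,
    schwartzExpNeg_apply, Complex.real_smul, ← Complex.ofReal_mul, mul_comm]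

theorem schwartzToL2_oscillatorEigenSchwartz (hω : ∀ j, 0 < ω j) (k : Fin d → ℕ) :
    schwartzToL2 (oscillatorEigenSchwartz hω k) = oscillatorEigenvector hω k :=
  MemLp.toLp_congr ((oscillatorEigenSchwartz hω k).memLp 2 volume)
    (memLp_oscillatorEigenfunction hω k) (ae_of_all _ (oscillatorEigenSchwartz_apply hω k))

theorem lineDerivOp_lineDerivOp_oscillatorEigenSchwartz (hω : ∀ j, 0 < ω j) (k : Fin d → ℕ)
    (j : Fin d) (x : EuclideanSpace ℝ (Fin d)) :
    ∂_{EuclideanSpace.basisFun (Fin d) ℝ j} (∂_{EuclideanSpace.basisFun (Fin d) ℝ j}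
      (oscillatorEigenSchwartz hω k)) x =
      ((ω j ^ 2 * x j ^ 2 - ω j * (2 * k j + 1) : ℝ) : ℂ) * oscillatorEigenSchwartz hω k x := by
  set r : ℝ := ∏ i ∈ Finset.univ.erase j, scaledHermiteFunction (ω i) (k i) (x i)
  set φ := scaledHermiteFunction (ω j) (k j)
  have hline (t : ℝ) : oscillatorEigenSchwartz hω k
      (x + t • EuclideanSpace.basisFun (Fin d) ℝ j) = ((φ (t + x j) * r : ℝ) : ℂ) := by
    rw [oscillatorEigenSchwartz_apply, oscillatorEigenfunction_eq_prod,
      ← Finset.mul_prod_erase _ _ (Finset.mem_univ j)]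
    congr 2
    · simp [φ, add_comm]
    · refine Finset.prod_congr rfl fun i hi => ?_
      simp [Finset.ne_of_mem_erase hi]
  have hfirst (t : ℝ) : HasDerivAt (fun t => ((φ (t + x j) * r : ℝ) : ℂ))
      ((deriv φ (t + x j) * r : ℝ) : ℂ) t :=
    (((hasDerivAt_scaledHermiteFunction (ω j) (k j) _).differentiableAt.hasDerivAt.comp_add_const
      t (x j)).mul_const r).ofReal_comp
  have hsecond := (((hasDerivAt_deriv_scaledHermiteFunction (hω j).le (k j) _).comp_add_const
    0 (x j)).mul_const r).ofReal_comp.deriv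
  rw [lineDerivOp_lineDerivOp_eq_deriv_deriv, funext hline, funext fun t => (hfirst t).deriv,
    hsecond, ← add_zero x, ← zero_smul ℝ (EuclideanSpace.basisFun (Fin d) ℝ j), hline]
  simp [φ, mul_assoc]

theorem schrodingerCLM_oscillatorEigenSchwartz (hω : ∀ j, 0 < ω j) (k : Fin d → ℕ) :
    schrodingerCLM (trapPotential ω) (oscillatorEigenSchwartz hω k) =
      (oscillatorEigenvalue ω k : ℂ) • oscillatorEigenSchwartz hω k := by
  have hV := hasTemperateGrowth_real_trapPotential ω
  ext x
  rw [schrodingerCLM_eq hV, SchwartzMap.laplacian_eq_sum (EuclideanSpace.basisFun (Fin d) ℝ),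
    add_apply, neg_apply, sum_apply, SchwartzMap.smulLeftCLM_apply_apply hV, smul_apply]
  simp only [lineDerivOp_lineDerivOp_oscillatorEigenSchwartz]
  rw [← Finset.sum_mul, ← Complex.ofReal_sum, Finset.sum_sub_distrib, trapPotential,
    oscillatorEigenvalue, Complex.real_smul, smul_eq_mul]
  push_cast
  ring

theorem orthonormal_oscillatorEigenvector (hω : ∀ j, 0 < ω j) :
    Orthonormal ℂ (oscillatorEigenvector hω) := by
  classical
  rw [orthonormal_iff_ite]
  intro k l
  have hprod (x : EuclideanSpace ℝ (Fin d)) :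
      inner ℂ (oscillatorEigenSchwartz hω k x) (oscillatorEigenSchwartz hω l x) =
      ((∏ j, scaledHermiteFunction (ω j) (k j) (x j) * scaledHermiteFunction (ω j) (l j) (x j) : ℝ)
        : ℂ) := by
    rw [oscillatorEigenSchwartz_apply, oscillatorEigenSchwartz_apply, RCLike.inner_apply,
      Complex.conj_ofReal, ← Complex.ofReal_mul, Finset.prod_mul_distrib, mul_comm]
    rfl
  rw [← schwartzToL2_oscillatorEigenSchwartz, ← schwartzToL2_oscillatorEigenSchwartz,
    SchwartzMap.toLpCLM_apply, SchwartzMap.toLpCLM_apply,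
    SchwartzMap.inner_toL2_toL2_eq _ _ volume]
  simp only [hprod]
  rw [integral_complex_ofReal, integral_euclideanSpace_prod_eq_prod fun j y =>
    scaledHermiteFunction (ω j) (k j) y * scaledHermiteFunction (ω j) (l j) y]
  simp only [integral_scaledHermiteFunction_mul_scaledHermiteFunction (hω _)]
  by_cases hkl : k = l
  · simp [hkl]
  · obtain ⟨j, hj⟩ := Function.ne_iff.1 hkl
    rw [Finset.prod_eq_zero (Finset.mem_univ j) (if_neg hj), if_neg hkl, Complex.ofReal_zero]

end Eigenfunctions

section Determinacy

variable {E : Type*} [NormedAddCommGroup E] [InnerProductSpace ℝ E] [FiniteDimensional ℝ E]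
  [MeasurableSpace E] [BorelSpace E]

theorem ae_eq_zero_of_fourier_eq_zero {G : E → ℂ} (hG : Integrable G)
    (hGF : ∀ ξ, 𝓕 G ξ = 0) : ∀ᵐ x, G x = 0 := by
  have integral_schwartz_mul (f : 𝓢(E, ℂ)) : ∫ x, f x * G x = 0 := by
    have hparseval : ∫ x, 𝓕 ((𝓕⁻ f : 𝓢(E, ℂ)) : E → ℂ) x * G x =
        ∫ x, (𝓕⁻ f : 𝓢(E, ℂ)) x * 𝓕 G x := by
      simpa using! VectorFourier.integral_bilin_fourierIntegral_eq_flip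
        (ContinuousLinearMap.mul ℂ ℂ) (L := innerₗ E) Real.continuous_fourierChar continuous_inner
        ((𝓕⁻ f : 𝓢(E, ℂ)).integrable (μ := volume)) hG
    rw [← SchwartzMap.fourier_coe, FourierTransform.fourier_fourierInv_eq f] at hparseval
    simp [hparseval, hGF]
  refine ae_eq_zero_of_integral_contDiff_smul_eq_zero hG.locallyIntegrable fun g hg hc => ?_
  have hsupp : HasCompactSupport (Complex.ofRealCLM ∘ g) := hc.comp_left rfl
  have hsmooth : ContDiff ℝ (⊤ : ℕ∞) (Complex.ofRealCLM ∘ g) := by fun_prop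
  simpa using integral_schwartz_mul (hsupp.toSchwartzMap hsmooth)

theorem integral_exp_mul_eq_zero {α : Type*} [MeasurableSpace α] {μ : Measure α} {z G : α → ℂ}
    (hz : AEStronglyMeasurable z μ) (hG : AEStronglyMeasurable G μ)
    (hzG : Integrable (fun x => Real.exp ‖z x‖ * ‖G x‖) μ)
    (hmom : ∀ n : ℕ, ∫ x, z x ^ n * G x ∂μ = 0) : ∫ x, Complex.exp (z x) * G x ∂μ = 0 := by
  have hsum_norm (x : α) : HasSum (fun n : ℕ => ‖z x‖ ^ n / n.factorial * ‖G x‖)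
      (Real.exp ‖z x‖ * ‖G x‖) := by
    rw [Real.exp_eq_exp_ℝ]
    exact (NormedSpace.expSeries_div_hasSum_exp ‖z x‖).mul_right _
  have hseries := hasSum_integral_of_dominated_convergence (μ := μ)
    (F := fun (n : ℕ) x => (n.factorial : ℂ)⁻¹ * (z x ^ n * G x))
    (f := fun x => Complex.exp (z x) * G x)
    (fun n x => ‖z x‖ ^ n / n.factorial * ‖G x‖)
    (fun n => ((hz.pow n).mul hG).const_mul _)
    (fun n => ae_of_all _ fun x => le_of_eq ?_) (ae_of_all _ fun x => (hsum_norm x).summable) ?_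
    (ae_of_all _ fun x => ?_)
  · simp only [integral_const_mul, hmom, mul_zero] at hseries
    exact hseries.unique hasSum_zero
  · rw [norm_mul, norm_mul, norm_inv, norm_pow, RCLike.norm_natCast]
    ring
  · simpa only [(hsum_norm _).tsum_eq] using hzG
  · rw [Complex.exp_eq_exp_ℂ]
    refine ((NormedSpace.expSeries_div_hasSum_exp (z x)).mul_right (G x)).congr_fun fun n => ?_
    ring

theorem fourier_eq_zero_of_integral_inner_pow_mul_eq_zero {G : E → ℂ}
    (hG : ∀ a : ℝ, Integrable fun x => Real.exp (a * ‖x‖) * G x)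
    (hmom : ∀ (ξ : E) (n : ℕ), ∫ x, (⟪x, ξ⟫_ℝ : ℂ) ^ n * G x = 0) (ξ : E) : 𝓕 G ξ = 0 := by
  have hGm : AEStronglyMeasurable G := by simpa using (hG 0).aestronglyMeasurable
  have hphase (x : E) : ‖((-2 * Real.pi * ⟪x, ξ⟫_ℝ : ℝ) : ℂ) * Complex.I‖ ≤
      2 * Real.pi * ‖ξ‖ * ‖x‖ := by
    rw [norm_mul, Complex.norm_I, mul_one, Complex.norm_real, Real.norm_eq_abs, abs_mul,
      abs_of_neg (by linarith [Real.pi_pos] : -2 * Real.pi < 0)]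
    nlinarith [abs_real_inner_le_norm x ξ, Real.pi_pos]
  rw [Real.fourier_eq']
  refine integral_exp_mul_eq_zero (Continuous.aestronglyMeasurable (by fun_prop)) hGm
    ((hG (2 * Real.pi * ‖ξ‖)).mono ?_ (ae_of_all _ fun x => ?_)) fun n => ?_
  · exact (Continuous.aestronglyMeasurable (by fun_prop)).mul hGm.norm
  · rw [norm_mul (Real.exp _), norm_mul (Real.exp _ : ℂ), Complex.norm_real, norm_norm,
      Real.norm_of_nonneg (Real.exp_nonneg _), Real.norm_of_nonneg (Real.exp_nonneg _)]
    gcongr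
    exact hphase x
  · have hpow (x : E) : (((-2 * Real.pi * ⟪x, ξ⟫_ℝ : ℝ) : ℂ) * Complex.I) ^ n * G x =
        (-2 * Real.pi * Complex.I) ^ n * ((⟪x, ξ⟫_ℝ : ℂ) ^ n * G x) := by
      push_cast
      ring
    simp only [hpow, integral_const_mul, hmom, mul_zero]

theorem integrable_exp_mul_norm_mul_schwartzExpNeg_mul {q : E → ℝ} (hq : q.HasTemperateGrowth)
    (hqc : ∃ c, 0 < c ∧ ∀ x, c * ‖x‖ ^ 2 ≤ q x) {g : E → ℂ} (hg : MemLp g 2 volume) (a : ℝ) :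
    Integrable fun x => Real.exp (a * ‖x‖) * (schwartzExpNeg hq hqc x * g x) := by
  obtain ⟨c, hc, hcq⟩ := id hqc
  have hgaussian : MemLp (fun x : E => Real.exp (a ^ 2 / (2 * c)) * Real.exp (-(c / 2 * ‖x‖ ^ 2)))
      2 volume := by
    refine MemLp.const_mul ?_ _
    have h := ((schwartzExpNeg (q := fun x : E => c / 2 * ‖x‖ ^ 2) (by fun_prop)
      ⟨c / 2, half_pos hc, fun x => le_rfl⟩).memLp 2 volume).norm
    simpa only [schwartzExpNeg_apply, Complex.norm_real, Real.norm_eq_abs, Real.abs_exp] using h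
  have hbound : MemLp (fun x => Real.exp (a * ‖x‖) * schwartzExpNeg hq hqc x) 2 volume := by
    refine hgaussian.of_le (Continuous.aestronglyMeasurable ?_) (ae_of_all _ fun x => ?_)
    · have := (schwartzExpNeg hq hqc).continuous
      fun_prop
    · have hsq : a ^ 2 / (2 * c) - c / 2 * ‖x‖ ^ 2 - (a * ‖x‖ - c * ‖x‖ ^ 2) =
          (a - c * ‖x‖) ^ 2 / (2 * c) := by
        field_simp
        ring
      have : 0 ≤ (a - c * ‖x‖) ^ 2 / (2 * c) := by positivity
      rw [schwartzExpNeg_apply, ← Complex.ofReal_mul, Complex.norm_real, ← Real.exp_add,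
        ← Real.exp_add, Real.norm_of_nonneg (Real.exp_nonneg _),
        Real.norm_of_nonneg (Real.exp_nonneg _)]
      exact Real.exp_le_exp.2 (by linarith [hcq x])
  exact (hbound.integrable_mul hg).congr (ae_of_all _ fun x => mul_assoc _ _ _)

end Determinacy

section HermiteSpan

open Polynomial

variable {ι : Type*} [Fintype ι]

/-- The probabilists' Hermite polynomials over `R` as a sequence of polynomials of degrees
`0, 1, 2, …`, hence a basis of `R[X]`. -/
noncomputable def hermiteSequence (R : Type*) [CommRing R] [Nontrivial R] :
    Polynomial.Sequence R where
  elems' n := (hermite n).map (Int.castRingHom R)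
  degree_eq' n := by rw [(hermite_monic n).degree_map, degree_hermite]

theorem mvPolynomial_linearMap_eq_zero {R M : Type*} [CommRing R] [IsDomain R]
    [AddCommGroup M] [Module R M] {L : MvPolynomial ι R →ₗ[R] M}
    (hL : ∀ k : ι → ℕ, L (∏ j, aeval (MvPolynomial.X j) (hermite (k j))) = 0) : L = 0 := by
  classical
  have hlead (n : ℕ) : IsUnit (hermiteSequence R n).leadingCoeff := by
    rw [show (hermiteSequence R n).leadingCoeff = 1 from (hermite_monic n).map _]
    exact isUnit_one
  let T : MultilinearMap R (fun _ : ι => R[X]) M :=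
    (L.compMultilinearMap (MultilinearMap.mkPiAlgebra R ι (MvPolynomial ι R))).compLinearMap
      fun j => (aeval (MvPolynomial.X j)).toLinearMap
  have hT : T = 0 := Module.Basis.ext_multilinear
    (fun _ => (hermiteSequence R).basis hlead) fun k => by
      have hk (j : ι) : aeval (MvPolynomial.X j : MvPolynomial ι R)
          (hermiteSequence R (k j)) = aeval (MvPolynomial.X j) (hermite (k j)) :=
        aeval_map_algebraMap R _ _
      simpa [T, hk] using hL k
  refine MvPolynomial.linearMap_ext fun s => LinearMap.ext_ring ?_
  simpa [T, MvPolynomial.monomial_eq, Finsupp.prod_fintype] using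
    congr_arg (fun T => T fun j => (X : R[X]) ^ s j) hT

theorem integral_eval_mul_eq_zero {α : Type*} [MeasurableSpace α] {μ : Measure α}
    {w : α → ι → ℂ} {G : α → ℂ}
    (hint : ∀ P : MvPolynomial ι ℂ, Integrable (fun x => MvPolynomial.eval (w x) P * G x) μ)
    (hherm : ∀ k : ι → ℕ, ∫ x, (∏ j, aeval (w x j) (hermite (k j))) * G x ∂μ = 0)
    (P : MvPolynomial ι ℂ) : ∫ x, MvPolynomial.eval (w x) P * G x ∂μ = 0 := by
  let L : MvPolynomial ι ℂ →ₗ[ℂ] ℂ :=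
    { toFun := fun P => ∫ x, MvPolynomial.eval (w x) P * G x ∂μ
      map_add' := fun P Q => by
        simp only [map_add, add_mul]
        exact integral_add (hint P) (hint Q)
      map_smul' := fun c P => by
        simp only [MvPolynomial.smul_eval, mul_assoc, integral_const_mul, RingHom.id_apply,
          smul_eq_mul] }
  have hL : L = 0 := mvPolynomial_linearMap_eq_zero fun k => by
    have heval (x : α) (j : ι) : MvPolynomial.eval (w x) (aeval (MvPolynomial.X j)
        (hermite (k j))) = aeval (w x j) (hermite (k j)) := by
      simpa using!
        (aeval_algHom_apply (MvPolynomial.eval (w x)).toIntAlgHom (MvPolynomial.X j) _).symm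
    simpa only [L, LinearMap.coe_mk, AddHom.coe_mk, map_prod, heval] using hherm k
  exact LinearMap.congr_fun hL P

end HermiteSpan

section Completeness

open Polynomial

theorem hasTemperateGrowth_eval {E ι : Type*} [NormedAddCommGroup E] [NormedSpace ℝ E]
    {w : E → ι → ℂ} (hw : ∀ j, (fun x => w x j).HasTemperateGrowth) (P : MvPolynomial ι ℂ) :
    (fun x => MvPolynomial.eval (w x) P).HasTemperateGrowth := by
  induction P using MvPolynomial.induction_on with
  | C a => simpa only [MvPolynomial.eval_C] using .const a
  | add P Q hP hQ =>
    simp only [map_add]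
    fun_prop
  | mul_X P j hP =>
    have := hw j
    simp only [map_mul, MvPolynomial.eval_X]
    fun_prop

variable {d : ℕ} {ω : Fin d → ℝ}

/-- The coordinates in which `φ_k` is a constant multiple of a product of probabilists' Hermite
polynomials times the ground state. -/
noncomputable def hermiteCoord (ω : Fin d → ℝ) (x : EuclideanSpace ℝ (Fin d)) (j : Fin d) : ℂ :=
  ((√(2 * ω j) * x j : ℝ) : ℂ)

theorem integrable_eval_hermiteCoord_mul (hω : ∀ j, 0 < ω j) {g : EuclideanSpace ℝ (Fin d) → ℂ}
    (hg : MemLp g 2 volume) (P : MvPolynomial (Fin d) ℂ) :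
    Integrable fun x => MvPolynomial.eval (hermiteCoord ω x) P * (groundState hω x * g x) := by
  have hcoord (j : Fin d) : (fun x => hermiteCoord ω x j).HasTemperateGrowth := by
    have := hasTemperateGrowth_euclideanSpace_apply j
    unfold hermiteCoord
    fun_prop
  have hP := hasTemperateGrowth_eval hcoord P
  refine (((SchwartzMap.smulLeftCLM ℂ (fun x => MvPolynomial.eval (hermiteCoord ω x) P)
    (groundState hω)).memLp 2 volume).integrable_mul hg).congr (ae_of_all _ fun x => ?_)
  simp only [Pi.mul_apply, SchwartzMap.smulLeftCLM_apply_apply hP, smul_eq_mul, mul_assoc]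

theorem inner_oscillatorEigenvector_eq_mul_integral_hermite (hω : ∀ j, 0 < ω j) (k : Fin d → ℕ)
    (g : Lp ℂ 2 (volume : Measure (EuclideanSpace ℝ (Fin d)))) :
    inner ℂ (oscillatorEigenvector hω k) g =
      ((∏ j, ω j ^ (1 / 4 : ℝ) * (√((k j).factorial * √Real.pi))⁻¹ : ℝ) : ℂ) *
        ∫ x, (∏ j, aeval (hermiteCoord ω x j) (hermite (k j))) * (groundState hω x * g x) := by
  rw [L2.inner_def, ← integral_const_mul]
  refine integral_congr_ae ?_
  filter_upwards [(memLp_oscillatorEigenfunction hω k).coeFn_toLp] with x hx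
  have haeval (j : Fin d) : aeval (hermiteCoord ω x j) (hermite (k j)) =
      ((aeval (√(2 * ω j) * x j) (hermite (k j)) : ℝ) : ℂ) :=
    aeval_algebraMap_apply ℂ (√(2 * ω j) * x j) (hermite (k j))
  rw [oscillatorEigenvector, hx, RCLike.inner_apply, Complex.conj_ofReal,
    oscillatorEigenfunction_eq_exp_mul hω, oscillatorPolynomial, Finset.prod_mul_distrib,
    groundState, schwartzExpNeg_apply]
  simp only [haeval]
  push_cast
  ring

theorem inner_eq_eval_hermiteCoord (hω : ∀ j, 0 < ω j) (x ξ : EuclideanSpace ℝ (Fin d)) :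
    (⟪x, ξ⟫_ℝ : ℂ) = MvPolynomial.eval (hermiteCoord ω x)
      (∑ j, MvPolynomial.C (ξ j / √(2 * ω j) : ℂ) * MvPolynomial.X j) := by
  rw [PiLp.inner_apply, map_sum, Complex.ofReal_sum]
  refine Finset.sum_congr rfl fun j _ => ?_
  have : (√(2 * ω j) : ℂ) ≠ 0 :=
    Complex.ofReal_ne_zero.2 (Real.sqrt_pos.2 (mul_pos two_pos (hω j))).ne'
  simp only [RCLike.inner_apply, conj_trivial, map_mul, MvPolynomial.eval_C, MvPolynomial.eval_X,
    hermiteCoord, Complex.ofReal_mul]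
  field_simp

theorem eq_zero_of_inner_oscillatorEigenvector_eq_zero (hω : ∀ j, 0 < ω j)
    {g : Lp ℂ 2 (volume : Measure (EuclideanSpace ℝ (Fin d)))}
    (hgk : ∀ k, inner ℂ (oscillatorEigenvector hω k) g = 0) : g = 0 := by
  have hexp (a : ℝ) :
      Integrable fun x => Real.exp (a * ‖x‖) * (groundState hω x * g x) :=
    integrable_exp_mul_norm_mul_schwartzExpNeg_mul (hasTemperateGrowth_groundExponent ω)
      (exists_mul_norm_sq_le_groundExponent hω) (Lp.memLp g) a
  have hherm (k : Fin d → ℕ) :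
      ∫ x, (∏ j, aeval (hermiteCoord ω x j) (hermite (k j))) * (groundState hω x * g x) = 0 := by
    have hk := (inner_oscillatorEigenvector_eq_mul_integral_hermite hω k g).symm.trans (hgk k)
    refine (mul_eq_zero.1 hk).resolve_left (Complex.ofReal_ne_zero.2 ?_)
    refine (Finset.prod_pos fun j _ => ?_).ne'
    have := Real.rpow_pos_of_pos (hω j) (1 / 4)
    have := Real.pi_pos
    positivity
  have hpoly := integral_eval_mul_eq_zero
    (integrable_eval_hermiteCoord_mul hω (Lp.memLp g)) hherm
  have hfourier := fourier_eq_zero_of_integral_inner_pow_mul_eq_zero hexp fun ξ n => by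
    simpa only [inner_eq_eval_hermiteCoord hω, ← map_pow] using hpoly _
  rw [Lp.eq_zero_iff_ae_eq_zero]
  filter_upwards [ae_eq_zero_of_fourier_eq_zero (by simpa using hexp 0) hfourier] with x hx
  simpa [groundState] using hx

/-- The Hilbert basis of `L²(ℝᵈ; ℂ)` that consists of the eigenfunctions `φ_k`. -/
noncomputable def oscillatorBasis (hω : ∀ j, 0 < ω j) :
    HilbertBasis (Fin d → ℕ) ℂ (Lp ℂ 2 (volume : Measure (EuclideanSpace ℝ (Fin d)))) :=
  HilbertBasis.mkOfOrthogonalEqBot (orthonormal_oscillatorEigenvector hω) <|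
    (Submodule.eq_bot_iff _).2 fun _ hg =>
      eq_zero_of_inner_oscillatorEigenvector_eq_zero hω fun k =>
        (Submodule.mem_orthogonal _ _).1 hg _ (Submodule.subset_span ⟨k, rfl⟩)

theorem oscillatorBasis_apply (hω : ∀ j, 0 < ω j) (k : Fin d → ℕ) :
    oscillatorBasis hω k = oscillatorEigenvector hω k := by
  rw [oscillatorBasis, HilbertBasis.coe_mkOfOrthogonalEqBot]

end Completeness

section Domain

open Filter
open scoped Topology

variable {d : ℕ} {ω : Fin d → ℝ}

theorem harmonicOscillator_apply (ω : Fin d → ℝ) (T : 𝓢'(EuclideanSpace ℝ (Fin d), ℂ))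
    (g : 𝓢(EuclideanSpace ℝ (Fin d), ℂ)) :
    harmonicOscillator ω T g = T (schrodingerCLM (trapPotential ω) g) := by
  rw [schrodingerCLM_eq (hasTemperateGrowth_real_trapPotential ω), map_add, map_neg,
    ← laplacian_apply_apply,
    ← SchwartzMap.smulLeftCLM_ofReal ℂ (hasTemperateGrowth_real_trapPotential ω),
    ← smulLeftCLM_apply_apply]
  rfl

theorem continuous_harmonicOscillator (ω : Fin d → ℝ) : Continuous (harmonicOscillator ω) :=
  (LineDeriv.laplacianCLM ℝ (EuclideanSpace ℝ (Fin d))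
    𝓢'(EuclideanSpace ℝ (Fin d), ℂ)).continuous.neg.add
    (smulLeftCLM ℂ fun x => (trapPotential ω x : ℂ)).continuous

theorem isHarmonicOscillatorValue_schwartzToL2 (ω : Fin d → ℝ)
    (f : 𝓢(EuclideanSpace ℝ (Fin d), ℂ)) :
    IsHarmonicOscillatorValue ω (schwartzToL2 f)
      (schwartzToL2 (schrodingerCLM (trapPotential ω) f)) := by
  have hV := hasTemperateGrowth_real_trapPotential ω
  rw [IsHarmonicOscillatorValue, harmonicOscillator, SchwartzMap.toLpCLM_apply,
    SchwartzMap.toLpCLM_apply, Lp.toTemperedDistribution_toLp_eq,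
    Lp.toTemperedDistribution_toLp_eq, laplacian_toTemperedDistributionCLM_eq,
    schrodingerCLM_eq hV, map_add, map_neg]
  congr 1
  ext g
  simp only [smulLeftCLM_apply_apply, SchwartzMap.toTemperedDistributionCLM_apply_apply,
    SchwartzMap.smulLeftCLM_apply_apply hV, Complex.real_smul, smul_eq_mul,
    SchwartzMap.smulLeftCLM_apply_apply (hasTemperateGrowth_trapPotential ω), mul_assoc,
    mul_left_comm]

theorem isHarmonicOscillatorValue_of_tendsto {ι : Type*} {l : Filter ι} [l.NeBot]
    {u f : ι → Lp ℂ 2 (volume : Measure (EuclideanSpace ℝ (Fin d)))}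
    {u₀ f₀ : Lp ℂ 2 (volume : Measure (EuclideanSpace ℝ (Fin d)))}
    (hu : Tendsto u l (𝓝 u₀)) (hf : Tendsto f l (𝓝 f₀))
    (huf : ∀ i, IsHarmonicOscillatorValue ω (u i) (f i)) : IsHarmonicOscillatorValue ω u₀ f₀ := by
  have hembed : Continuous fun u : Lp ℂ 2 (volume : Measure (EuclideanSpace ℝ (Fin d))) =>
      Lp.toTemperedDistribution u := (Lp.toTemperedDistributionCLM ℂ volume 2).continuous
  refine tendsto_nhds_unique
    ((((continuous_harmonicOscillator ω).comp hembed).tendsto u₀).comp hu) ?_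
  exact ((hembed.tendsto f₀).comp hf).congr fun i => (huf i).symm

theorem inner_oscillatorEigenvector_eq_toTemperedDistribution (hω : ∀ j, 0 < ω j)
    (k : Fin d → ℕ) (u : Lp ℂ 2 (volume : Measure (EuclideanSpace ℝ (Fin d)))) :
    inner ℂ (oscillatorEigenvector hω k) u =
      Lp.toTemperedDistribution u (oscillatorEigenSchwartz hω k) := by
  rw [L2.inner_def, Lp.toTemperedDistribution_apply]
  refine integral_congr_ae ?_
  filter_upwards [(memLp_oscillatorEigenfunction hω k).coeFn_toLp] with x hx
  rw [oscillatorEigenvector, hx, RCLike.inner_apply, Complex.conj_ofReal,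
    oscillatorEigenSchwartz_apply, smul_eq_mul, mul_comm]

theorem inner_oscillatorEigenvector_of_isHarmonicOscillatorValue (hω : ∀ j, 0 < ω j)
    {u f : Lp ℂ 2 (volume : Measure (EuclideanSpace ℝ (Fin d)))}
    (huf : IsHarmonicOscillatorValue ω u f) (k : Fin d → ℕ) :
    inner ℂ (oscillatorEigenvector hω k) f =
      oscillatorEigenvalue ω k * inner ℂ (oscillatorEigenvector hω k) u := by
  rw [inner_oscillatorEigenvector_eq_toTemperedDistribution,
    inner_oscillatorEigenvector_eq_toTemperedDistribution, huf.symm, harmonicOscillator_apply,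
    schrodingerCLM_oscillatorEigenSchwartz, map_smul, smul_eq_mul]

theorem hasSum_inner_smul_oscillatorEigenvector (hω : ∀ j, 0 < ω j)
    (u : Lp ℂ 2 (volume : Measure (EuclideanSpace ℝ (Fin d)))) :
    HasSum (fun k => inner ℂ (oscillatorEigenvector hω k) u • oscillatorEigenvector hω k) u := by
  simpa only [HilbertBasis.repr_apply_apply, oscillatorBasis_apply] using
    (oscillatorBasis hω).hasSum_repr u

theorem exists_seq_tendsto_schwartzToL2 (hω : ∀ j, 0 < ω j)
    {u f : Lp ℂ 2 (volume : Measure (EuclideanSpace ℝ (Fin d)))}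
    (huf : ∀ k, inner ℂ (oscillatorEigenvector hω k) f =
      oscillatorEigenvalue ω k * inner ℂ (oscillatorEigenvector hω k) u) :
    ∃ p : ℕ → 𝓢(EuclideanSpace ℝ (Fin d), ℂ),
      Tendsto (fun n => schwartzToL2 (p n)) atTop (𝓝 u) ∧
      Tendsto (fun n => schwartzToL2 (schrodingerCLM (trapPotential ω) (p n))) atTop (𝓝 f) := by
  let P (s : Finset (Fin d → ℕ)) : 𝓢(EuclideanSpace ℝ (Fin d), ℂ) :=
    ∑ k ∈ s, inner ℂ (oscillatorEigenvector hω k) u • oscillatorEigenSchwartz hω k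
  have hPu : Tendsto (fun s => schwartzToL2 (P s)) atTop (𝓝 u) := by
    refine (hasSum_inner_smul_oscillatorEigenvector hω u).congr fun s => ?_
    simp only [P, map_sum, map_smul, schwartzToL2_oscillatorEigenSchwartz]
  have hPf : Tendsto (fun s => schwartzToL2 (schrodingerCLM (trapPotential ω) (P s)))
      atTop (𝓝 f) := by
    refine (hasSum_inner_smul_oscillatorEigenvector hω f).congr fun s => ?_
    simp only [P, map_sum, map_smul, schrodingerCLM_oscillatorEigenSchwartz,
      schwartzToL2_oscillatorEigenSchwartz, huf, smul_smul, mul_comm]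
  obtain ⟨s, hs⟩ := exists_seq_tendsto (atTop : Filter (Finset (Fin d → ℕ)))
  exact ⟨fun n => P (s n), hPu.comp hs, hPf.comp hs⟩

theorem isHarmonicOscillatorValue_iff_inner (hω : ∀ j, 0 < ω j)
    {u f : Lp ℂ 2 (volume : Measure (EuclideanSpace ℝ (Fin d)))} :
    IsHarmonicOscillatorValue ω u f ↔ ∀ k, inner ℂ (oscillatorEigenvector hω k) f =
      oscillatorEigenvalue ω k * inner ℂ (oscillatorEigenvector hω k) u := by
  refine ⟨inner_oscillatorEigenvector_of_isHarmonicOscillatorValue hω, fun huf => ?_⟩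
  obtain ⟨p, hpu, hpf⟩ := exists_seq_tendsto_schwartzToL2 hω huf
  exact isHarmonicOscillatorValue_of_tendsto hpu hpf fun n =>
    isHarmonicOscillatorValue_schwartzToL2 ω (p n)

theorem hermiteSobolevTerm_two (hω : ∀ j, 0 < ω j)
    (u : Lp ℂ 2 (volume : Measure (EuclideanSpace ℝ (Fin d)))) (k : Fin d → ℕ) :
    hermiteSobolevTerm hω 2 u k =
      ‖(oscillatorEigenvalue ω k : ℂ) * inner ℂ (oscillatorEigenvector hω k) u‖ ^ 2 := by
  rw [hermiteSobolevTerm, norm_mul, Complex.norm_real, Real.norm_eq_abs, mul_pow, sq_abs,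
    Real.rpow_two]

theorem hasSum_norm_inner_oscillatorEigenvector_sq (hω : ∀ j, 0 < ω j)
    (f : Lp ℂ 2 (volume : Measure (EuclideanSpace ℝ (Fin d)))) :
    HasSum (fun k => ‖inner ℂ (oscillatorEigenvector hω k) f‖ ^ 2) (‖f‖ ^ 2) := by
  have hparseval := ((oscillatorBasis hω).hasSum_inner_mul_inner f f).mapL Complex.reCLM
  simpa only [oscillatorBasis_apply, Complex.reCLM_apply, inner_mul_symm_re_eq_norm, norm_mul,
    norm_inner_symm f, ← sq, ← RCLike.re_eq_complex_re, ← norm_sq_eq_re_inner] using hparseval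

theorem hasSum_hermiteSobolevTerm_two (hω : ∀ j, 0 < ω j)
    {u f : Lp ℂ 2 (volume : Measure (EuclideanSpace ℝ (Fin d)))}
    (huf : IsHarmonicOscillatorValue ω u f) : HasSum (hermiteSobolevTerm hω 2 u) (‖f‖ ^ 2) := by
  refine (hasSum_norm_inner_oscillatorEigenvector_sq hω f).congr_fun fun k => ?_
  rw [hermiteSobolevTerm_two, inner_oscillatorEigenvector_of_isHarmonicOscillatorValue hω huf]

theorem mem_hermiteSobolev_two_iff (hω : ∀ j, 0 < ω j)
    (u : Lp ℂ 2 (volume : Measure (EuclideanSpace ℝ (Fin d)))) :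
    u ∈ hermiteSobolev hω 2 ↔ ∃ f, IsHarmonicOscillatorValue ω u f := by
  refine ⟨fun hu => ?_, fun ⟨f, huf⟩ => (hasSum_hermiteSobolevTerm_two hω huf).summable⟩
  have hl2 : Memℓp (fun k => (oscillatorEigenvalue ω k : ℂ) *
      inner ℂ (oscillatorEigenvector hω k) u) 2 := by
    rw [memℓp_gen_iff (by norm_num)]
    refine Summable.congr (show Summable (hermiteSobolevTerm hω 2 u) from hu) fun k => ?_
    rw [hermiteSobolevTerm_two, ENNReal.toReal_ofNat, Real.rpow_two]
  refine ⟨(oscillatorBasis hω).repr.symm ⟨_, hl2⟩,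
    (isHarmonicOscillatorValue_iff_inner hω).2 fun k => ?_⟩
  conv_lhs => rw [← oscillatorBasis_apply, ← HilbertBasis.repr_apply_apply,
    LinearIsometryEquiv.apply_symm_apply]

theorem hermiteSobolevNorm_two (hω : ∀ j, 0 < ω j)
    {u f : Lp ℂ 2 (volume : Measure (EuclideanSpace ℝ (Fin d)))}
    (huf : IsHarmonicOscillatorValue ω u f) : hermiteSobolevNorm hω 2 u = ‖f‖ := by
  rw [hermiteSobolevNorm, (hasSum_hermiteSobolevTerm_two hω huf).tsum_eq,
    Real.sqrt_sq (norm_nonneg _)]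

theorem norm_le_inv_mul_of_isHarmonicOscillatorValue (hω : ∀ j, 0 < ω j) (hd : 1 ≤ d)
    {u f : Lp ℂ 2 (volume : Measure (EuclideanSpace ℝ (Fin d)))}
    (huf : IsHarmonicOscillatorValue ω u f) : ‖u‖ ≤ (∑ j, ω j)⁻¹ * ‖f‖ := by
  have hbottom : 0 < ∑ j, ω j := Finset.sum_pos (fun j _ => hω j) ⟨⟨0, hd⟩, Finset.mem_univ _⟩
  have heigenvalue (k : Fin d → ℕ) : ∑ j, ω j ≤ oscillatorEigenvalue ω k :=
    Finset.sum_le_sum fun j _ =>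
      le_mul_of_one_le_right (hω j).le (by linarith [(k j).cast_nonneg (α := ℝ)])
  rw [inv_mul_eq_div, le_div_iff₀ hbottom]
  refine le_of_sq_le_sq ?_ (norm_nonneg _)
  rw [mul_pow]
  refine hasSum_le (fun k => ?_)
    ((hasSum_norm_inner_oscillatorEigenvector_sq hω u).mul_right ((∑ j, ω j) ^ 2))
    (hasSum_hermiteSobolevTerm_two hω huf)
  rw [hermiteSobolevTerm, Real.rpow_two, mul_comm]
  gcongr
  exact heigenvalue k

end Domain

section Product

open Filter
open scoped Topology ENNReal

theorem Lp_ae_eq_mul_of_tendsto {α R : Type*} {m : MeasurableSpace α} {μ : Measure α}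
    [NormedRing R] {p q r : ℝ≥0∞} [Fact (1 ≤ p)] [Fact (1 ≤ q)] [Fact (1 ≤ r)]
    {f : ℕ → Lp R p μ} {g : ℕ → Lp R q μ} {h : ℕ → Lp R r μ}
    {u : Lp R p μ} {v : Lp R q μ} {w : Lp R r μ} (hf : Tendsto f atTop (𝓝 u))
    (hg : Tendsto g atTop (𝓝 v)) (hh : Tendsto h atTop (𝓝 w))
    (hmul : ∀ n, ∀ᵐ x ∂μ, h n x = f n x * g n x) : ∀ᵐ x ∂μ, w x = u x * v x := by
  obtain ⟨a, ha, hfa⟩ := (tendstoInMeasure_of_tendsto_Lp hf).exists_seq_tendsto_ae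
  obtain ⟨b, hb, hgb⟩ :=
    (tendstoInMeasure_of_tendsto_Lp (hg.comp ha.tendsto_atTop)).exists_seq_tendsto_ae
  obtain ⟨c, hc, hhc⟩ := (tendstoInMeasure_of_tendsto_Lp
    (hh.comp (ha.comp hb).tendsto_atTop)).exists_seq_tendsto_ae
  filter_upwards [hfa, hgb, hhc, ae_all_iff.2 hmul] with x hfx hgx hhx hmulx
  refine tendsto_nhds_unique hhx (((hfx.comp (hb.comp hc).tendsto_atTop).mul
    (hgx.comp hc.tendsto_atTop)).congr fun n => ?_)
  exact (hmulx _).symm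

theorem cauchySeq_schwartzToL2_schrodingerCLM_schwartzMul {E : Type*} [NormedAddCommGroup E]
    [InnerProductSpace ℝ E] [FiniteDimensional ℝ E] [MeasurableSpace E] [BorelSpace E]
    {V : E → ℝ} {C : ℝ}
    (hC : ∀ f g, ‖schwartzToL2 (schrodingerCLM V (schwartzMul f g))‖ ≤
      C * ‖schwartzToL2 (schrodingerCLM V f)‖ * ‖schwartzToL2 (schrodingerCLM V g)‖)
    {p q : ℕ → 𝓢(E, ℂ)} {f g : Lp ℂ 2 (volume : Measure E)}
    (hp : Tendsto (fun n => schwartzToL2 (schrodingerCLM V (p n))) atTop (𝓝 f))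
    (hq : Tendsto (fun n => schwartzToL2 (schrodingerCLM V (q n))) atTop (𝓝 g)) :
    CauchySeq fun n => schwartzToL2 (schrodingerCLM V (schwartzMul (p n) (q n))) := by
  have hdist (n : ℕ × ℕ) : dist (schwartzToL2 (schrodingerCLM V (schwartzMul (p n.1) (q n.1))))
      (schwartzToL2 (schrodingerCLM V (schwartzMul (p n.2) (q n.2)))) ≤
      C * dist (schwartzToL2 (schrodingerCLM V (p n.1))) (schwartzToL2 (schrodingerCLM V (p n.2))) *
        ‖schwartzToL2 (schrodingerCLM V (q n.1))‖ +
      C * ‖schwartzToL2 (schrodingerCLM V (p n.2))‖ *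
        dist (schwartzToL2 (schrodingerCLM V (q n.1)))
          (schwartzToL2 (schrodingerCLM V (q n.2))) := by
    have hsub : schwartzMul (p n.1) (q n.1) - schwartzMul (p n.2) (q n.2) =
        schwartzMul (p n.1 - p n.2) (q n.1) + schwartzMul (p n.2) (q n.1 - q n.2) := by
      ext x
      simp only [sub_apply, add_apply, schwartzMul_apply]
      ring
    simp only [dist_eq_norm, ← map_sub, hsub, map_add]
    exact (norm_add_le _ _).trans (add_le_add (hC _ _) (hC _ _))
  have hfst := hq.norm.comp (tendsto_fst (f := atTop) (g := (atTop : Filter ℕ)))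
  have hsnd := hp.norm.comp (tendsto_snd (f := (atTop : Filter ℕ)) (g := atTop))
  rw [prod_atTop_atTop_eq] at hfst hsnd
  rw [cauchySeq_iff_tendsto_dist_atTop_0]
  refine squeeze_zero (fun _ => dist_nonneg) hdist ?_
  simpa using (((cauchySeq_iff_tendsto_dist_atTop_0.1 hp.cauchySeq).const_mul C).mul hfst).add
    ((hsnd.const_mul C).mul (cauchySeq_iff_tendsto_dist_atTop_0.1 hq.cauchySeq))

theorem exists_isHarmonicOscillatorValue_mul {d : ℕ} {ω : Fin d → ℝ} (hω : ∀ j, 0 < ω j)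
    (hd : 1 ≤ d) {C : ℝ}
    (hC : ∀ f g, ‖schwartzToL2 (schrodingerCLM (trapPotential ω) (schwartzMul f g))‖ ≤
      C * ‖schwartzToL2 (schrodingerCLM (trapPotential ω) f)‖ *
        ‖schwartzToL2 (schrodingerCLM (trapPotential ω) g)‖)
    {u v f g : Lp ℂ 2 (volume : Measure (EuclideanSpace ℝ (Fin d)))}
    (huf : IsHarmonicOscillatorValue ω u f) (hvg : IsHarmonicOscillatorValue ω v g) :
    ∃ w h, IsHarmonicOscillatorValue ω w h ∧ (∀ᵐ x, w x = u x * v x) ∧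
      ‖h‖ ≤ C * ‖f‖ * ‖g‖ := by
  obtain ⟨p, hpu, hpf⟩ :=
    exists_seq_tendsto_schwartzToL2 hω ((isHarmonicOscillatorValue_iff_inner hω).1 huf)
  obtain ⟨q, hqv, hqg⟩ :=
    exists_seq_tendsto_schwartzToL2 hω ((isHarmonicOscillatorValue_iff_inner hω).1 hvg)
  have hcauchy := cauchySeq_schwartzToL2_schrodingerCLM_schwartzMul hC hpf hqg
  have hcauchy' : CauchySeq fun n => schwartzToL2 (schwartzMul (p n) (q n)) := by
    rw [cauchySeq_iff_tendsto_dist_atTop_0] at hcauchy ⊢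
    have hlim := hcauchy.const_mul (∑ j, ω j)⁻¹
    rw [mul_zero] at hlim
    refine squeeze_zero (fun _ => dist_nonneg) (fun n => ?_) hlim
    rw [dist_eq_norm, dist_eq_norm, ← map_sub, ← map_sub, ← map_sub]
    exact norm_le_inv_mul_of_isHarmonicOscillatorValue hω hd
      (isHarmonicOscillatorValue_schwartzToL2 ω _)
  obtain ⟨h, hh⟩ := cauchySeq_tendsto_of_complete hcauchy
  obtain ⟨w, hw⟩ := cauchySeq_tendsto_of_complete hcauchy'
  refine ⟨w, h, isHarmonicOscillatorValue_of_tendsto hw hh fun n =>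
    isHarmonicOscillatorValue_schwartzToL2 ω _, Lp_ae_eq_mul_of_tendsto hpu hqv hw fun n => ?_,
    le_of_tendsto_of_tendsto' hh.norm ((hpf.norm.const_mul C).mul hqg.norm)
      fun n => hC (p n) (q n)⟩
  filter_upwards [coeFn_schwartzToL2 (schwartzMul (p n) (q n)), coeFn_schwartzToL2 (p n),
    coeFn_schwartzToL2 (q n)] with x hpqx hpx hqx
  rw [hpqx, hpx, hqx, schwartzMul_apply]

end Product

theorem mainTheorem9 (d : ℕ) (hd1 : 1 ≤ d) (hd3 : d ≤ 3) (ω : Fin d → ℝ)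
    (hω : ∀ j, 0 < ω j) :
    -- `H̃²` is the domain of `A = -Δ + Ω`, and its norm is `‖Au‖`
    (∀ u : Lp ℂ 2 (volume : Measure (EuclideanSpace ℝ (Fin d))),
      u ∈ hermiteSobolev hω 2 ↔ ∃ f, IsHarmonicOscillatorValue ω u f) ∧
    (∀ u f : Lp ℂ 2 (volume : Measure (EuclideanSpace ℝ (Fin d))),
      IsHarmonicOscillatorValue ω u f → hermiteSobolevNorm hω 2 u = ‖f‖) ∧
    -- `H̃²` is an algebra with the pointwise product
    ∃ C : ℝ, 0 < C ∧ ∀ u ∈ hermiteSobolev hω 2, ∀ v ∈ hermiteSobolev hω 2,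
      ∃ w ∈ hermiteSobolev hω 2, (∀ᵐ x, w x = u x * v x) ∧
        hermiteSobolevNorm hω 2 w ≤
          C * hermiteSobolevNorm hω 2 u * hermiteSobolevNorm hω 2 v := by
  obtain ⟨C, hC, hmul⟩ := exists_norm_schrodingerCLM_schwartzMul_le
    (by rw [finrank_euclideanSpace_fin]; lia) (hasTemperateGrowth_real_trapPotential ω)
    (trapPotential_nonneg ω) (fun x => (laplacian_trapPotential ω x).le) fun f =>
      norm_le_inv_mul_of_isHarmonicOscillatorValue hω hd1
        (isHarmonicOscillatorValue_schwartzToL2 ω f)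
  refine ⟨mem_hermiteSobolev_two_iff hω, fun u f => hermiteSobolevNorm_two hω, C, hC,
    fun u hu v hv => ?_⟩
  obtain ⟨f, huf⟩ := (mem_hermiteSobolev_two_iff hω u).1 hu
  obtain ⟨g, hvg⟩ := (mem_hermiteSobolev_two_iff hω v).1 hv
  obtain ⟨w, h, hwh, hw, hle⟩ := exists_isHarmonicOscillatorValue_mul hω hd1 hmul huf hvg
  refine ⟨w, (mem_hermiteSobolev_two_iff hω w).2 ⟨h, hwh⟩, hw, ?_⟩
  rwa [hermiteSobolevNorm_two hω hwh, hermiteSobolevNorm_two hω huf, hermiteSobolevNorm_two hω hvg]
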